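/- **Conventions.** Let a group $G$ act linearly on a finite-dimensional complex vector space $V$. A vector $v\in V$ is *semistable* if $0\notin\overline{G\cdot v}$, *polystable* if $G\cdot v$ is closed and $0\notin G\cdot v$, and *stable* if it is polystable and its stabilizer in $G$ is finite. For a configuration $P=(p_1,\dots,p_m)\in(\mathbb P^n)^m$ of points $p_j=(p_j^0:\dots:p_j^n)$ over $\mathbb C$ let $f_P=\prod_{j=1}^m\big(\sum_{i=0}^n p_j^i x_i\big)\in V=\mathbb C[x_0,\dots,x_n]_m$ (well defined up to a non-zero factor), with the action $(g\cdot f)(x)=f(g^{-1}x)$ of $G=SL(n+1,\mathbb C)$. The configuration $P$ is (semi/poly)stable in $\mathbb P^n$ if $f_P$ is (semi/poly)stable for $G$. (Semi/poly)stability of a configuration in a projective subspace of dimension $d-1$ is defined in the same way, with $SL(d,\mathbb C)$, after a choice of homogeneous coordinates on the subspace. *Relative stability.* Let $T$ be a maximal torus of $G_{[f_P]}=\{g\in G: g\cdot f_P\in\mathbb C f_P\}$ and let $Z_G(T)$ be the identity component of the centralizer of $T$ in $G$. The group $G_T=Z_G(T)/T$ is made to act on $V$ through a connected algebraic subgroup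 $H\subseteq Z_G(T)$ such that $Z_G(T)=H\cdot T$ and $H\cap T$ is finite, i.e. which maps onto $Z_G(T)/T$ with finite kernel. $P$ is *relatively (semi/poly)stable* if $f_P$ is (semi/poly)stable for the action of $H$. *Decomposition.* Let $\Lambda\subseteq\mathbb P^n$ be the projective subspace spanned by the points of $P$. An orthogonal decomposition $\Lambda=\Lambda_1+\dots+\Lambda_s$ is a decomposition into projective subspaces such that each $\Lambda_j$ contains some point of $P$, each point of $P$ lies in some $\Lambda_j$, and $\Lambda_j\cap\sum_{\ell\ne j}\Lambda_\ell=\emptyset$ for all $j$. It is irreducible if every orthogonal decomposition of $\Lambda$ has at most $s$ summands. **Theorem.** Let $P\in(\mathbb P^n)^m$ be a configuration of points with span $\Lambda$, and let $\Lambda=\Lambda_1+\dots+\Lambda_s$ be an irreducible orthogonal decomposition. For each $j$ let $P_j$ be the configuration of the points of $P$ (with multiplicity) contained in $\Lambda_j$. Then pairs $(T,H)$ as above exist, and for every such pair: 1. $P$ is relatively semistable (with respect to $(T,H)$) if and only if each $P_j$ is semistable in $\Lambda_j$; 2. $P$ is relatively polystable if and only if each $P_j$ is polystable in $\Lambda_j$;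 3. $P$ is relatively stable if and only if each $P_j$ is stable in $\Lambda_j$. In particular, relative (semi/poly)stability of $P$ does not depend on the choice of $(T,H)$. -/

import Mathlib

open scoped LinearAlgebra.Projectivization

namespace RelGIT

noncomputable section

/-! ### Stability for a linear action of a group on a topological vector space -/

/-- The orbit of `v` under the linear action `ρ`. -/
def orbit {G V : Type*} [Group G] [AddCommGroup V] [Module ℂ V]
    (ρ : Representation ℂ G V) (v : V) : Set V :=
  Set.range fun g : G => ρ g v

/-- `v` is semistable if `0` is not in the closure of its orbit. -/
def IsSemistable {G V : Type*} [Group G] [AddCommGroup V] [Module ℂ V] [TopologicalSpace V]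
    (ρ : Representation ℂ G V) (v : V) : Prop :=
  (0 : V) ∉ closure (orbit ρ v)

/-- `v` is polystable if its orbit is closed and does not contain `0`. -/
def IsPolystable {G V : Type*} [Group G] [AddCommGroup V] [Module ℂ V] [TopologicalSpace V]
    (ρ : Representation ℂ G V) (v : V) : Prop :=
  IsClosed (orbit ρ v) ∧ (0 : V) ∉ orbit ρ v

/-- `v` is stable if it is polystable and its stabilizer is finite. -/
def IsStable {G V : Type*} [Group G] [AddCommGroup V] [Module ℂ V] [TopologicalSpace V]
    (ρ : Representation ℂ G V) (v : V) : Prop :=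
  IsPolystable ρ v ∧ {g : G | ρ g v = v}.Finite

/-- The restriction of a linear action to a subgroup. -/
abbrev restrict {G V : Type*} [Group G] [AddCommGroup V] [Module ℂ V]
    (ρ : Representation ℂ G V) (H : Subgroup G) : Representation ℂ H V :=
  MonoidHom.comp ρ H.subtype

/-! ### Tori, identity components and relative stability -/

/-- The stabilizer `G_[v] = {g | g • v ∈ ℂ v}` of the line spanned by `v`. -/
def lineStabilizer {G V : Type*} [Group G] [AddCommGroup V] [Module ℂ V]
    (ρ : Representation ℂ G V) (v : V) : Subgroup G where
  carrier := {g | ρ g v ∈ Submodule.span ℂ {v}}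
  one_mem' := by simp
  mul_mem' := by
    intro a b ha hb
    change ρ a v ∈ Submodule.span ℂ {v} at ha
    change ρ b v ∈ Submodule.span ℂ {v} at hb
    change ρ (a * b) v ∈ Submodule.span ℂ {v}
    rw [Submodule.mem_span_singleton] at ha hb ⊢
    obtain ⟨c, hc⟩ := ha
    obtain ⟨d, hd⟩ := hb
    refine ⟨d * c, ?_⟩
    rw [map_mul, Module.End.mul_apply, ← hd, map_smul, ← hc, mul_smul]
  inv_mem' := by
    intro a ha
    change ρ a v ∈ Submodule.span ℂ {v} at ha
    change ρ a⁻¹ v ∈ Submodule.span ℂ {v}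
    rw [Submodule.mem_span_singleton] at ha ⊢
    obtain ⟨c, hc⟩ := ha
    have h1 : ρ a⁻¹ (ρ a v) = v := by
      rw [← Module.End.mul_apply, ← map_mul]; simp
    rw [← hc, map_smul] at h1
    rcases eq_or_ne c 0 with h0 | h0
    · refine ⟨0, ?_⟩
      have hv : v = 0 := by rw [← h1, h0, zero_smul]
      simp [hv]
    · refine ⟨c⁻¹, ?_⟩
      conv_lhs => rw [← h1]
      rw [smul_smul, inv_mul_cancel₀ h0, one_smul]

/-- `T` is an algebraic torus in `SL(σ, ℂ)`: the image of an injective homomorphism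
`(ℂˣ)^r → SL(σ, ℂ)` whose matrix entries are polynomials in the coordinates `t_a` and their
inverses `t_a⁻¹`. -/
def IsTorus {σ : Type*} [Fintype σ] [DecidableEq σ]
    (T : Subgroup (Matrix.SpecialLinearGroup σ ℂ)) : Prop :=
  ∃ (r : ℕ) (φ : (Fin r → ℂˣ) →* Matrix.SpecialLinearGroup σ ℂ),
    Function.Injective φ ∧
    (∀ i j : σ, ∃ F : MvPolynomial (Fin r ⊕ Fin r) ℂ, ∀ t : Fin r → ℂˣ,
      (φ t : Matrix σ σ ℂ) i j =
        MvPolynomial.eval (Sum.elim (fun a => (t a : ℂ)) fun a => ((t a)⁻¹ : ℂˣ)) F) ∧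
    φ.range = T

/-- `T` is a maximal torus of the subgroup `K` of `SL(σ, ℂ)`. -/
def IsMaximalTorus {σ : Type*} [Fintype σ] [DecidableEq σ]
    (K T : Subgroup (Matrix.SpecialLinearGroup σ ℂ)) : Prop :=
  Maximal (fun S => IsTorus S ∧ S ≤ K) T

/-- The identity component of a subgroup of a topological group. -/
def identityComponent {G : Type*} [TopologicalSpace G] [Group G] [IsTopologicalGroup G]
    (K : Subgroup G) : Subgroup G :=
  (Subgroup.connectedComponentOfOne K).map K.subtype

/-- `Z_G(T)`: the identity component of the centralizer of `T` in `G`. -/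
def connectedCentralizer {G : Type*} [TopologicalSpace G] [Group G] [IsTopologicalGroup G]
    (T : Subgroup G) : Subgroup G :=
  identityComponent (Subgroup.centralizer (T : Set G))

/-- `H` is an algebraic subgroup of `SL(σ, ℂ)`: it is cut out by polynomial equations in the
matrix entries. -/
def IsAlgebraic {σ : Type*} [Fintype σ] [DecidableEq σ]
    (H : Subgroup (Matrix.SpecialLinearGroup σ ℂ)) : Prop :=
  ∃ S : Set (MvPolynomial (σ × σ) ℂ), ∀ g : Matrix.SpecialLinearGroup σ ℂ,
    g ∈ H ↔ ∀ F ∈ S, MvPolynomial.eval (fun ij => (g : Matrix σ σ ℂ) ij.1 ij.2) F = 0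

/-- `H` realizes `G_T = Z_G(T)/T` inside `Z_G(T)`: it is a connected algebraic subgroup of
`Z_G(T)` that maps onto `Z_G(T)/T` with finite kernel (so the image of an algebraic section of
`Z_G(T) → Z_G(T)/T`, if there is one, is of this kind; in general the sequence
`1 → T → Z_G(T) → Z_G(T)/T → 1` splits only up to a finite group). -/
structure IsLift {σ : Type*} [Fintype σ] [DecidableEq σ]
    (T H : Subgroup (Matrix.SpecialLinearGroup σ ℂ)) : Prop where
  algebraic : IsAlgebraic H
  connected : IsConnected (H : Set (Matrix.SpecialLinearGroup σ ℂ))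
  le : H ≤ connectedCentralizer T
  surjective : ∀ z ∈ connectedCentralizer T, ∃ h ∈ H, ∃ t ∈ T, z = h * t
  finite_kernel : ((H : Set (Matrix.SpecialLinearGroup σ ℂ)) ∩ T).Finite

/-- The data from which relative stability of `v` is defined: a maximal torus `T` of `G_[v]`
and a subgroup `H` of `Z_G(T)` realizing `G_T = Z_G(T)/T`. Then `v` is relatively
(semi/poly)stable when it is (semi/poly)stable for the action of `H`. -/
def IsRelativeDatum {σ V : Type*} [Fintype σ] [DecidableEq σ] [AddCommGroup V] [Module ℂ V]
    (ρ : Representation ℂ (Matrix.SpecialLinearGroup σ ℂ) V) (v : V)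
    (T H : Subgroup (Matrix.SpecialLinearGroup σ ℂ)) : Prop :=
  IsMaximalTorus (lineStabilizer ρ v) T ∧ IsLift T H

/-! ### Forms of degree `m` and the action of the special linear group -/

/-- The space of forms of degree `m` in the variables `x_i`, `i : σ`. -/
abbrev Form (σ : Type*) (m : ℕ) : Type _ :=
  MvPolynomial.homogeneousSubmodule σ ℂ m

/-- The topology of coefficientwise convergence; for finite `σ` it is the usual topology of the
finite dimensional complex vector space `Form σ m`. -/
instance Form.instTopologicalSpace (σ : Type*) (m : ℕ) : TopologicalSpace (Form σ m) :=
  TopologicalSpace.induced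
    (fun (f : Form σ m) (d : σ →₀ ℕ) => MvPolynomial.coeff d (f : MvPolynomial σ ℂ))
    inferInstance

/-- The substitution `x ↦ A x`, i.e. `x_i ↦ ∑ k, A i k * x_k`. -/
def substLinear {σ : Type*} [Fintype σ] (A : Matrix σ σ ℂ) :
    MvPolynomial σ ℂ →ₐ[ℂ] MvPolynomial σ ℂ :=
  MvPolynomial.aeval fun i => ∑ k, MvPolynomial.C (A i k) * MvPolynomial.X k

lemma substLinear_isHomogeneous {σ : Type*} [Fintype σ] (A : Matrix σ σ ℂ) {m : ℕ}
    {f : MvPolynomial σ ℂ} (hf : f.IsHomogeneous m) : (substLinear A f).IsHomogeneous m := by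
  have := hf.aeval (n := 1) (fun i => ∑ k, MvPolynomial.C (A i k) * MvPolynomial.X k)
    (fun i => MvPolynomial.IsHomogeneous.sum _ _ _
      fun k _ => MvPolynomial.isHomogeneous_C_mul_X _ _)
  simpa [substLinear] using this

lemma substLinear_one {σ : Type*} [Fintype σ] [DecidableEq σ] (f : MvPolynomial σ ℂ) :
    substLinear (1 : Matrix σ σ ℂ) f = f := by
  have : substLinear (1 : Matrix σ σ ℂ) = AlgHom.id ℂ _ := by
    ext1 i
    simp [substLinear, Matrix.one_apply]
  rw [this]; rfl

lemma substLinear_mul {σ : Type*} [Fintype σ] (A B : Matrix σ σ ℂ) (f : MvPolynomial σ ℂ) :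
    substLinear (A * B) f = substLinear B (substLinear A f) := by
  have : substLinear (A * B) = (substLinear B).comp (substLinear A) := by
    ext1 i
    simp only [substLinear, AlgHom.comp_apply, MvPolynomial.aeval_X, map_sum, map_mul,
      MvPolynomial.algHom_C, MvPolynomial.algebraMap_eq, Matrix.mul_apply, Finset.sum_mul,
      Finset.mul_sum]
    rw [Finset.sum_comm]
    simp [mul_assoc]
  rw [this]; rfl

/-- The linear endomorphism `f ↦ f(A x)` of the space of forms of degree `m`. -/
def substForm {σ : Type*} [Fintype σ] (m : ℕ) (A : Matrix σ σ ℂ) :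
    Form σ m →ₗ[ℂ] Form σ m where
  toFun f := ⟨substLinear A f.1, substLinear_isHomogeneous A f.2⟩
  map_add' f g := Subtype.ext (map_add (substLinear A) f.1 g.1)
  map_smul' c f := Subtype.ext (map_smul (substLinear A) c f.1)

/-- The action `(g • f)(x) = f(g⁻¹ x)` of `SL(σ, ℂ)` on forms of degree `m`. -/
def formRep (σ : Type*) [Fintype σ] [DecidableEq σ] (m : ℕ) :
    Representation ℂ (Matrix.SpecialLinearGroup σ ℂ) (Form σ m) where
  toFun g := substForm m ((g⁻¹ : Matrix.SpecialLinearGroup σ ℂ) : Matrix σ σ ℂ)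
  map_one' := by
    refine LinearMap.ext fun f => Subtype.ext ?_
    have h : ((1⁻¹ : Matrix.SpecialLinearGroup σ ℂ) : Matrix σ σ ℂ) = 1 := by simp
    exact (congrArg (fun A => substLinear A f.1) h).trans (substLinear_one _)
  map_mul' g h := by
    refine LinearMap.ext fun f => Subtype.ext ?_
    have e : (((g * h)⁻¹ : Matrix.SpecialLinearGroup σ ℂ) : Matrix σ σ ℂ) =
        ((h⁻¹ : Matrix.SpecialLinearGroup σ ℂ) : Matrix σ σ ℂ) *
          ((g⁻¹ : Matrix.SpecialLinearGroup σ ℂ) : Matrix σ σ ℂ) := by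
      rw [mul_inv_rev, Matrix.SpecialLinearGroup.coe_mul]
    exact (congrArg (fun A => substLinear A f.1) e).trans (substLinear_mul _ _ _)

/-! ### Configurations of points -/

/-- The linear form `∑ i, v i * x_i`. -/
def linForm {σ : Type*} [Fintype σ] (v : σ → ℂ) : MvPolynomial σ ℂ :=
  ∑ i, MvPolynomial.C (v i) * MvPolynomial.X i

/-- The form `f_P = ∏ l_j` of a configuration `P = (p_j)` of points of the projective space
`ℙ(ℂ^σ)`, where `l_j` is the linear form whose coefficients are homogeneous coordinates of
`p_j`. -/
def configForm {σ κ : Type*} [Fintype σ] [Fintype κ] (P : κ → ℙ ℂ (σ → ℂ)) :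
    Form σ (Fintype.card κ) :=
  ⟨∏ j, linForm (P j).rep, by
    have := MvPolynomial.IsHomogeneous.prod (Finset.univ : Finset κ)
      (fun j => linForm (P j).rep) (fun _ => 1)
      (fun j _ => MvPolynomial.IsHomogeneous.sum _ _ _
        fun k _ => MvPolynomial.isHomogeneous_C_mul_X _ _)
    simpa [MvPolynomial.mem_homogeneousSubmodule] using this⟩

/-- A configuration is semistable if its form is, for the action of `SL`. -/
def ConfigSemistable {σ κ : Type*} [Fintype σ] [DecidableEq σ] [Fintype κ]
    (P : κ → ℙ ℂ (σ → ℂ)) : Prop :=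
  IsSemistable (formRep σ (Fintype.card κ)) (configForm P)

/-- A configuration is polystable if its form is, for the action of `SL`. -/
def ConfigPolystable {σ κ : Type*} [Fintype σ] [DecidableEq σ] [Fintype κ]
    (P : κ → ℙ ℂ (σ → ℂ)) : Prop :=
  IsPolystable (formRep σ (Fintype.card κ)) (configForm P)

/-- A configuration is stable if its form is, for the action of `SL`. -/
def ConfigStable {σ κ : Type*} [Fintype σ] [DecidableEq σ] [Fintype κ]
    (P : κ → ℙ ℂ (σ → ℂ)) : Prop :=
  IsStable (formRep σ (Fintype.card κ)) (configForm P)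

/-- The pair `(T, H)` is the data from which relative stability of the configuration `P` is
defined, that is relative stability of the form `f_P` for the action of `SL`. -/
def ConfigRelativeDatum {σ κ : Type*} [Fintype σ] [DecidableEq σ] [Fintype κ]
    (P : κ → ℙ ℂ (σ → ℂ)) (T H : Subgroup (Matrix.SpecialLinearGroup σ ℂ)) : Prop :=
  IsRelativeDatum (formRep σ (Fintype.card κ)) (configForm P) T H

/-- `f_P` is semistable for the action of the subgroup `H` of `SL`. -/
def ConfigSemistableFor {σ κ : Type*} [Fintype σ] [DecidableEq σ] [Fintype κ]
    (H : Subgroup (Matrix.SpecialLinearGroup σ ℂ)) (P : κ → ℙ ℂ (σ → ℂ)) : Prop :=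
  IsSemistable (restrict (formRep σ (Fintype.card κ)) H) (configForm P)

/-- `f_P` is polystable for the action of the subgroup `H` of `SL`. -/
def ConfigPolystableFor {σ κ : Type*} [Fintype σ] [DecidableEq σ] [Fintype κ]
    (H : Subgroup (Matrix.SpecialLinearGroup σ ℂ)) (P : κ → ℙ ℂ (σ → ℂ)) : Prop :=
  IsPolystable (restrict (formRep σ (Fintype.card κ)) H) (configForm P)

/-- `f_P` is stable for the action of the subgroup `H` of `SL`. -/
def ConfigStableFor {σ κ : Type*} [Fintype σ] [DecidableEq σ] [Fintype κ]
    (H : Subgroup (Matrix.SpecialLinearGroup σ ℂ)) (P : κ → ℙ ℂ (σ → ℂ)) : Prop :=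
  IsStable (restrict (formRep σ (Fintype.card κ)) H) (configForm P)

/-- The indices of the points of `P` that lie on the projective subspace `ℙ(W)`. -/
abbrev IndicesIn {κ E : Type*} [AddCommGroup E] [Module ℂ E] (P : κ → ℙ ℂ E)
    (W : Submodule ℂ E) : Type _ :=
  {i : κ // (P i).submodule ≤ W}

instance IndicesIn.instFintype {κ E : Type*} [Fintype κ] [AddCommGroup E] [Module ℂ E]
    (P : κ → ℙ ℂ E) (W : Submodule ℂ E) : Fintype (IndicesIn P W) :=
  Fintype.ofFinite _

/-- The configuration of the points of `P` contained in `ℙ(W)`, with multiplicity, written in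
the homogeneous coordinates of `ℙ(W)` given by a basis `b` of `W`. -/
def subConfig {κ τ E : Type*} [Finite τ] [AddCommGroup E] [Module ℂ E] (P : κ → ℙ ℂ E)
    (W : Submodule ℂ E) (b : Module.Basis τ ℂ W) : IndicesIn P W → ℙ ℂ (τ → ℂ) :=
  fun i => Projectivization.mk ℂ
    (b.equivFun ⟨(P i.1).rep, i.2 (by
      rw [Projectivization.submodule_eq]; exact Submodule.mem_span_singleton_self _)⟩)
    (by
      rw [ne_eq, LinearEquiv.map_eq_zero_iff, Submodule.mk_eq_zero]
      exact (P i.1).rep_nonzero)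

/-- An orthogonal decomposition `Λ = Λ_1 + ⋯ + Λ_s` of the span `Λ` of the points of `P`:
projective subspaces of `ℙ(E)` are given by linear subspaces of `E`, and every `Λ_j` is disjoint
from the sum of the others, contains a point of `P`, and every point of `P` is in some `Λ_j`. -/
structure IsOrthogonalDecomposition {κ E : Type*} [AddCommGroup E] [Module ℂ E]
    (P : κ → ℙ ℂ E) {s : ℕ} (L : Fin s → Submodule ℂ E) : Prop where
  sum_eq : ⨆ j, L j = ⨆ i, (P i).submodule
  orthogonal : ∀ j, Disjoint (L j) (⨆ (l) (_ : l ≠ j), L l)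
  meets : ∀ j, ∃ i, (P i).submodule ≤ L j
  covers : ∀ i, ∃ j, (P i).submodule ≤ L j

/-- An irreducible orthogonal decomposition: one with the largest number of summands. -/
def IsIrreducibleDecomposition {κ E : Type*} [AddCommGroup E] [Module ℂ E]
    (P : κ → ℙ ℂ E) {s : ℕ} (L : Fin s → Submodule ℂ E) : Prop :=
  IsOrthogonalDecomposition P L ∧
    ∀ (s' : ℕ) (L' : Fin s' → Submodule ℂ E), IsOrthogonalDecomposition P L' → s' ≤ s

end

end RelGIT

/-!
Relative stability of a configuration decouples over an irreducible decomposition of its span. All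
matrices act on row vectors from the right, so that a substitution carries the linear form of `v` to
the linear form of `v ᵥ* A` (`substLinear_linForm`).

*Tori and lifts.* Complete bases of the summands `L j` to a basis `B` of the whole space, where the
vectors of the complement form blocks of size one. A matrix that fixes all points of `P` is scalar
on each `L j`: otherwise a generic combination of it with a map that separates the summands would
have more than `s` eigenvalues, and its eigenspaces would give a decomposition with more summands
(`exists_scalar_of_irreducible`). The stabilizer of the line of `f_P` permutes the points of `P`, by
unique factorization, and a torus is divisible, so a torus in this stabilizer fixes the points. If
the complement is spanned by eigenvectors of a given maximal torus, which is possible because tori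
are diagonalizable (`IsTorus.span_eigenvectors_eq_top`), then this torus consists of matrices that
are scalar on each block. By divisibility and maximality it is the group `scalarTorus B e` of those
with scalars `l b` such that `∏ b, l b ^ e b = 1`, where the `e b` are the block sizes divided by
their greatest common divisor (`IsAdaptedBasis.eq_scalarTorus`). Its centralizer consists of block
diagonal matrices, and the only lift of the quotient is the image of the product of the groups `SL`
of the blocks (`eq_range_blockSL_of_isLift`): a lift contains the commutators of this image, hence
all of it because `SL` is perfect, and it is a connected union of finitely many of its cosets.

*Products.* Up to a nonzero factor, `f_P` is the product of the forms of its parts, that is the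
value of a continuous multilinear map `μ` without zeros which is equivariant for `∏ SL`
(`exists_multilinear`). By compactness of spheres the norm of `μ v` is bounded below by a multiple
of the product of the norms of the `v b`. On a product of sets away from zero, `μ` therefore stays
away from zero, and it is proper if the sets are closed; so products of semistable or polystable
forms are semistable or polystable. Conversely, a factor that degenerates to zero makes the product
do so (`isSemistable_multilinear_iff`); and the stabilizer of `f_P` in `∏ SL` is finite, so that by
the open mapping theorem for group actions closed subgroups have closed orbits through `f_P` if the
whole group has (`isClosed_range_of_isClosed_orbit`), in particular the factors of `∏ SL`
(`isPolystable_multilinear_iff`). As all stabilizers in `∏ SL` are finite, stability and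
polystability coincide on both sides. The blocks of size one contribute no condition, because
`SL` is trivial there.
-/

namespace RelGIT

noncomputable section

/-! ### The special linear group is perfect and connected -/

open Matrix in
/-- The diagonal matrix with entries `c` and `c⁻¹`, as a product of transvections. -/
lemma diag2n_eq_transvection_prod {ι : Type*} [Fintype ι] [DecidableEq ι] {i j : ι} (hij : i ≠ j)
    {c : ℂ} (hc : c ≠ 0) :
    SpecialLinearGroup.diag2n hij c hc =
      SpecialLinearGroup.transvection hij c * (SpecialLinearGroup.transvection hij.symm (-c⁻¹) *
        (SpecialLinearGroup.transvection hij c * (SpecialLinearGroup.transvection hij (-1) *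
          (SpecialLinearGroup.transvection hij.symm 1 *
            SpecialLinearGroup.transvection hij (-1))))) := by
  refine Subtype.ext ?_
  have hji := hij.symm
  change diagonal _ = transvection i j c * (transvection j i (-c⁻¹) * (transvection i j c *
    (transvection i j (-1) * (transvection j i 1 * transvection i j (-1)))))
  rw [← Matrix.mul_one (transvection j i (1 : ℂ) * _), Matrix.mul_assoc]
  ext a b
  rcases eq_or_ne a i with rfl | hai
  · simp only [transvection_mul_apply_same, transvection_mul_apply_of_ne _ _ _ _ hij,
      transvection_mul_apply_of_ne _ _ _ _ hji, diagonal_apply, one_apply]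
    by_cases h1 : a = b
    · subst h1; simp [hji]; field_simp; simp
    · by_cases h2 : j = b
      · subst h2; simp [hij]; field_simp; ring
      · simp [h1, h2]
  · rcases eq_or_ne a j with rfl | haj
    · simp only [transvection_mul_apply_same, transvection_mul_apply_of_ne _ _ _ _ hij,
        transvection_mul_apply_of_ne _ _ _ _ hji, diagonal_apply, one_apply]
      by_cases h1 : a = b
      · subst h1; simp [hji, hij]
      · by_cases h2 : i = b
        · subst h2; simp [hji]; field_simp; simp
        · simp [h1, h2]
    · simp only [transvection_mul_apply_of_ne _ _ _ _ hai, transvection_mul_apply_of_ne _ _ _ _ haj,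
        diagonal_apply, one_apply, hai, haj]
      simp

/-- A subgroup of `SL(ι, ℂ)` that contains all transvections is the whole group. -/
lemma eq_top_of_transvection_mem {ι : Type*} [Fintype ι] [DecidableEq ι]
    (N : Subgroup (Matrix.SpecialLinearGroup ι ℂ))
    (h : ∀ (i j : ι) (hij : i ≠ j) (c : ℂ), Matrix.SpecialLinearGroup.transvection hij c ∈ N) :
    N = ⊤ := by
  rcases subsingleton_or_nontrivial ι with hι | hι
  · exact Subsingleton.elim _ _
  · refine (Subgroup.eq_top_iff' _).2 fun g =>
      Matrix.SpecialLinearGroup.diagonal_transvection_induction' (· ∈ N) g ?_ h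
        fun A B => N.mul_mem
    intro i j hij c hc
    rw [diag2n_eq_transvection_prod hij hc]
    exact N.mul_mem (h _ _ _ _) <| N.mul_mem (h _ _ _ _) <| N.mul_mem (h _ _ _ _) <|
      N.mul_mem (h _ _ _ _) <| N.mul_mem (h _ _ _ _) (h _ _ _ _)

open Matrix in
open scoped commutatorElement in
/-- `SL(ι, ℂ)` is perfect: every transvection is a commutator of a diagonal matrix and a
transvection. -/
lemma commutator_specialLinearGroup_eq_top {ι : Type*} [Fintype ι] [DecidableEq ι] :
    commutator (SpecialLinearGroup ι ℂ) = ⊤ := by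
  refine eq_top_of_transvection_mem _ fun i j hij c => ?_
  have h2 : (2 : ℂ) ≠ 0 := two_ne_zero
  have key : SpecialLinearGroup.diag2n hij 2 h2 * SpecialLinearGroup.transvection hij (c / 3) =
      SpecialLinearGroup.transvection hij c * SpecialLinearGroup.transvection hij (c / 3) *
        SpecialLinearGroup.diag2n hij 2 h2 := by
    refine Subtype.ext ?_
    change diagonal _ * transvection i j (c / 3) =
      transvection i j c * transvection i j (c / 3) * diagonal _
    rw [transvection_mul_transvection_same i j hij]
    ext a b
    simp only [transvection, Matrix.add_apply, Matrix.diagonal_mul, Matrix.mul_diagonal,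
      Matrix.single_apply]
    by_cases h : i = a ∧ j = b
    · obtain ⟨rfl, rfl⟩ := h
      simp [hij, hij.symm]; ring
    · rcases eq_or_ne a b with rfl | hab
      · simp [h]
      · simp [h, hab]
  have : SpecialLinearGroup.transvection hij c =
      ⁅SpecialLinearGroup.diag2n hij 2 h2, SpecialLinearGroup.transvection hij (c / 3)⁆ := by
    rw [commutatorElement_def, key, mul_inv_cancel_right, mul_inv_cancel_right]
  rw [this]
  exact Subgroup.commutator_mem_commutator (Subgroup.mem_top _) (Subgroup.mem_top _)

open Matrix in
/-- The identity component contains the one-parameter groups of transvections. -/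
instance connectedSpace_specialLinearGroup {ι : Type*} [Fintype ι] [DecidableEq ι] :
    ConnectedSpace (SpecialLinearGroup ι ℂ) := by
  have htop : Subgroup.connectedComponentOfOne (SpecialLinearGroup ι ℂ) = ⊤ := by
    refine eq_top_of_transvection_mem _ fun i j hij c => ?_
    have hcont : Continuous fun c : ℂ => SpecialLinearGroup.transvection hij c := by
      refine continuous_induced_rng.2 ?_
      change Continuous fun c : ℂ => (1 : Matrix ι ι ℂ) + single i j c
      refine continuous_const.add ?_
      refine continuous_matrix fun a b => ?_
      simp only [single_apply]
      split_ifs <;> fun_prop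
    have hpre := (isPreconnected_univ (α := ℂ)).image _ hcont.continuousOn
    refine hpre.subset_connectedComponent ?_ ⟨c, trivial, rfl⟩
    exact ⟨0, trivial, SpecialLinearGroup.transvection_coeff_zero hij⟩
  refine connectedSpace_iff_connectedComponent.2 ⟨1, ?_⟩
  have := congrArg (fun N : Subgroup _ => (N : Set (SpecialLinearGroup ι ℂ))) htop
  simpa [Subgroup.connectedComponentOfOne] using this

/-! ### Orbits of subgroups -/

/-- If the orbit of `v` under a σ-compact group is closed and the stabilizer of `v` is finite, then
closed subgroups have closed orbits through `v`: by the open mapping theorem the orbit is a quotient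
of the group, and the preimage of the smaller orbit is a finite union of cosets. -/
lemma isClosed_range_of_isClosed_orbit {G V : Type*} [Group G] [TopologicalSpace G]
    [IsTopologicalGroup G] [SigmaCompactSpace G] [AddCommGroup V] [Module ℂ V] [TopologicalSpace V]
    [T2Space V] [LocallyCompactSpace V] (ρ : Representation ℂ G V)
    (hρ : Continuous fun p : G × V => ρ p.1 p.2) (v : V) (hcl : IsClosed (orbit ρ v))
    (hfin : {g : G | ρ g v = v}.Finite) (N : Subgroup G) (hN : IsClosed (N : Set G)) :
    IsClosed ((fun g => ρ g v) '' (N : Set G)) := by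
  let _ : MulAction G V :=
    { smul := fun g w => ρ g w
      one_smul := fun w => by change ρ 1 w = w; simp
      mul_smul := fun g h w => by change ρ (g * h) w = ρ g (ρ h w); simp }
  have : ContinuousSMul G V := ⟨hρ⟩
  let X := MulAction.orbit G v
  have hXcl : IsClosed (X : Set V) := hcl
  have : LocallyCompactSpace X := hXcl.isClosedEmbedding_subtypeVal.locallyCompactSpace
  have : ContinuousSMul G X :=
    ⟨by
      refine continuous_induced_rng.2 ?_
      exact (continuous_fst.smul (continuous_subtype_val.comp continuous_snd) :
        Continuous fun p : G × X => p.1 • (p.2 : V))⟩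
  let x : X := ⟨v, MulAction.mem_orbit_self v⟩
  have hopen : IsOpenMap fun g : G => g • x := isOpenMap_smul_of_sigmaCompact x
  have hpre : IsClosed {g : G | ∃ n ∈ N, ρ n v = ρ g v} := by
    have : {g : G | ∃ n ∈ N, ρ n v = ρ g v} =
        ⋃ h ∈ {g : G | ρ g v = v}, (fun g => g * h⁻¹) ⁻¹' (N : Set G) := by
      ext g
      simp only [Set.mem_ofPred_eq, Set.mem_iUnion, Set.mem_preimage, SetLike.mem_coe, exists_prop]
      constructor
      · rintro ⟨n, hn, h⟩
        refine ⟨n⁻¹ * g, ?_, by simpa using hn⟩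
        rw [map_mul, Module.End.mul_apply, ← h, ← Module.End.mul_apply, ← map_mul]
        simp
      · rintro ⟨h, hh, hg⟩
        refine ⟨g * h⁻¹, hg, ?_⟩
        nth_rewrite 1 [← hh]
        rw [← Module.End.mul_apply, ← map_mul]
        simp
    rw [this]
    exact hfin.isClosed_biUnion fun h _ => hN.preimage (by fun_prop)
  have himg : IsOpen ((fun g : G => g • x) '' {g : G | ∃ n ∈ N, ρ n v = ρ g v}ᶜ) :=
    hopen _ hpre.isOpen_compl
  have hX : IsClosed ((↑) ⁻¹' ((fun g => ρ g v) '' (N : Set G)) : Set X) := by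
    rw [← isOpen_compl_iff]
    convert himg using 1
    ext ⟨w, g, rfl⟩
    simp only [Set.mem_compl_iff, Set.mem_preimage, Set.mem_image, SetLike.mem_coe,
      Set.mem_ofPred_eq, not_exists, not_and]
    constructor
    · intro h
      exact ⟨g, h, rfl⟩
    · rintro ⟨g', h, hg⟩ n hn hng
      refine h n hn (hng.trans ?_)
      exact (congrArg Subtype.val hg).symm
  have := hXcl.isClosedEmbedding_subtypeVal.isClosedMap _ hX
  rwa [Subtype.image_preimage_coe, Set.inter_eq_right.2] at this
  rintro _ ⟨n, -, rfl⟩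
  exact ⟨n, rfl⟩

/-! ### Multilinear maps without zeros -/

section Multilinear

variable {β : Type*}

/-- By compactness of products of spheres, a continuous multilinear map that vanishes only when one
of its arguments does is bounded below. -/
lemma exists_mul_prod_norm_le [Fintype β] {X : β → Type*} {Y : Type*}
    [∀ b, NormedAddCommGroup (X b)] [∀ b, NormedSpace ℂ (X b)] [∀ b, ProperSpace (X b)]
    [NormedAddCommGroup Y] [NormedSpace ℂ Y]
    (μ : MultilinearMap ℂ X Y) (hμ : Continuous μ) (hne : ∀ v, (∀ b, v b ≠ 0) → μ v ≠ 0) :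
    ∃ C > 0, ∀ v, C * ∏ b, ‖v b‖ ≤ ‖μ v‖ := by
  set K : Set (∀ b, X b) := Set.univ.pi fun b => Metric.sphere 0 1
  have hK : IsCompact K := isCompact_univ_pi fun b => isCompact_sphere _ _
  obtain ⟨C, hC, hCK⟩ : ∃ C > 0, ∀ v ∈ K, C ≤ ‖μ v‖ := by
    rcases K.eq_empty_or_nonempty with h | h
    · exact ⟨1, one_pos, by simp [h]⟩
    · obtain ⟨v, hv, hmin⟩ := hK.exists_isMinOn h (hμ.norm.continuousOn)
      refine ⟨‖μ v‖, norm_pos_iff.2 (hne v fun b hb => ?_), fun w hw => hmin hw⟩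
      have := hv b trivial
      simp [hb] at this
  refine ⟨C, hC, fun v => ?_⟩
  by_cases h : ∀ b, v b ≠ 0
  · have hv : v = fun b => (‖v b‖ : ℂ) • ((‖v b‖ : ℂ)⁻¹ • v b) := by
      funext b
      rw [smul_smul, mul_inv_cancel₀ (by simpa using h b), one_smul]
    have hu : (fun b => (‖v b‖ : ℂ)⁻¹ • v b) ∈ K := by
      intro b _
      have := h b
      simp [norm_smul, this]
    conv_rhs => rw [hv, μ.map_smul_univ, norm_smul, norm_prod]
    simp only [Complex.norm_real, norm_norm]
    rw [mul_comm]
    exact mul_le_mul_of_nonneg_left (hCK _ hu) (Finset.prod_nonneg fun _ _ => norm_nonneg _)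
  · push Not at h
    obtain ⟨b, hb⟩ := h
    rw [Finset.prod_eq_zero (Finset.mem_univ b) (by simp [hb])]
    simp

lemma exists_le_norm_of_zero_notMem_closure {X : Type*} [NormedAddCommGroup X] {O : Set X}
    (h : (0 : X) ∉ closure O) : ∃ δ > 0, ∀ u ∈ O, δ ≤ ‖u‖ := by
  rw [Metric.mem_closure_iff] at h
  push Not at h
  obtain ⟨δ, hδ, h⟩ := h
  exact ⟨δ, hδ, fun u hu => by simpa using h u hu⟩

lemma zero_notMem_closure_image_multilinear [Fintype β] {X : β → Type*} {Y : Type*}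
    [∀ b, NormedAddCommGroup (X b)]
    [∀ b, NormedSpace ℂ (X b)] [∀ b, ProperSpace (X b)] [NormedAddCommGroup Y] [NormedSpace ℂ Y]
    (μ : MultilinearMap ℂ X Y) (hμ : Continuous μ) (hne : ∀ v, (∀ b, v b ≠ 0) → μ v ≠ 0)
    (O : ∀ b, Set (X b)) (hO : ∀ b, (0 : X b) ∉ closure (O b)) :
    (0 : Y) ∉ closure (μ '' Set.univ.pi O) := by
  obtain ⟨C, hC, hCμ⟩ := exists_mul_prod_norm_le μ hμ hne
  choose δ hδ hδO using fun b => exists_le_norm_of_zero_notMem_closure (hO b)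
  have hpos : 0 < C * ∏ b, δ b := mul_pos hC (Finset.prod_pos fun b _ => hδ b)
  rw [Metric.mem_closure_iff]
  push Not
  refine ⟨_, hpos, ?_⟩
  rintro _ ⟨v, hv, rfl⟩
  rw [dist_zero_left]
  refine le_trans (mul_le_mul_of_nonneg_left ?_ hC.le) (hCμ v)
  exact Finset.prod_le_prod (fun b _ => (hδ b).le) fun b _ => hδO b _ (hv b trivial)

/-- The lower bound makes `μ` proper on products of closed sets that avoid `0`. -/
lemma isClosed_image_multilinear [Fintype β] {X : β → Type*} {Y : Type*}
    [∀ b, NormedAddCommGroup (X b)]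
    [∀ b, NormedSpace ℂ (X b)] [∀ b, ProperSpace (X b)] [NormedAddCommGroup Y] [NormedSpace ℂ Y]
    (μ : MultilinearMap ℂ X Y) (hμ : Continuous μ) (hne : ∀ v, (∀ b, v b ≠ 0) → μ v ≠ 0)
    (O : ∀ b, Set (X b)) (hcl : ∀ b, IsClosed (O b)) (hO : ∀ b, (0 : X b) ∉ O b) :
    IsClosed (μ '' Set.univ.pi O) := by
  classical
  obtain ⟨C, hC, hCμ⟩ := exists_mul_prod_norm_le μ hμ hne
  choose δ hδ hδO using fun b =>
    exists_le_norm_of_zero_notMem_closure (by rw [(hcl b).closure_eq]; exact hO b)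
  rw [← closure_subset_iff_isClosed]
  intro w hw
  set R : β → ℝ := fun b => (‖w‖ + 1) / (C * ∏ b' ∈ Finset.univ.erase b, δ b')
  have hpos : ∀ b, 0 < C * ∏ b' ∈ Finset.univ.erase b, δ b' := fun b =>
    mul_pos hC (Finset.prod_pos fun b _ => hδ b)
  set K : Set (∀ b, X b) := Set.univ.pi fun b => O b ∩ Metric.closedBall 0 (R b)
  have hK : IsCompact K :=
    isCompact_univ_pi fun b => (isCompact_closedBall _ _).inter_left (hcl b)
  have hKcl : IsClosed (μ '' K) := (hK.image hμ).isClosed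
  have hKO : K ⊆ Set.univ.pi O := Set.pi_mono fun b _ => Set.inter_subset_left
  refine Set.image_mono hKO ?_
  rw [← hKcl.closure_eq]
  have hw' : w ∈ closure (Metric.ball w 1 ∩ μ '' Set.univ.pi O) :=
    Metric.isOpen_ball.inter_closure ⟨Metric.mem_ball_self one_pos, hw⟩
  refine closure_mono ?_ hw'
  rintro _ ⟨hball, v, hv, rfl⟩
  refine ⟨v, fun b _ => ⟨hv b trivial, ?_⟩, rfl⟩
  -- the other factors are bounded below, so a bound for `μ v` bounds `v b`
  rw [mem_closedBall_zero_iff, le_div_iff₀ (hpos b)]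
  have h1 : ‖μ v‖ ≤ ‖w‖ + 1 := by
    have := norm_sub_norm_le (μ v) w
    rw [Metric.mem_ball, dist_eq_norm] at hball
    linarith
  refine le_trans ?_ ((hCμ v).trans h1)
  rw [← Finset.mul_prod_erase _ _ (Finset.mem_univ b), mul_left_comm]
  refine mul_le_mul_of_nonneg_left (mul_le_mul_of_nonneg_left ?_ (norm_nonneg _)) hC.le
  exact Finset.prod_le_prod (fun b _ => (hδ b).le) fun b _ => hδO b _ (hv b trivial)

variable {V : β → Type*} {W : Type*} [∀ b, AddCommGroup (V b)] [∀ b, Module ℂ (V b)]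
  [∀ b, TopologicalSpace (V b)] [∀ b, IsTopologicalAddGroup (V b)] [∀ b, ContinuousSMul ℂ (V b)]
  [∀ b, T2Space (V b)] [∀ b, FiniteDimensional ℂ (V b)] [AddCommGroup W] [Module ℂ W]
  [TopologicalSpace W] [IsTopologicalAddGroup W] [ContinuousSMul ℂ W] [T2Space W]
  [FiniteDimensional ℂ W]

/-- A finite dimensional Hausdorff complex vector space is isomorphic to a coordinate space. -/
abbrev coordEquiv (W : Type*) [AddCommGroup W] [Module ℂ W]
    [TopologicalSpace W] [IsTopologicalAddGroup W] [ContinuousSMul ℂ W] [T2Space W]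
    [FiniteDimensional ℂ W] : W ≃L[ℂ] (Fin (Module.finrank ℂ W) → ℂ) :=
  (Module.finBasis ℂ W).equivFunL

/-- A multilinear map read in coordinates of its arguments and its values. -/
def coordMultilinear (μ : MultilinearMap ℂ V W) :
    MultilinearMap ℂ (fun b => Fin (Module.finrank ℂ (V b)) → ℂ)
      (Fin (Module.finrank ℂ W) → ℂ) :=
  ((coordEquiv W : W →ₗ[ℂ] _).compMultilinearMap μ).compLinearMap
    fun b => ((coordEquiv (V b)).symm : _ →ₗ[ℂ] V b)

lemma coordMultilinear_apply (μ : MultilinearMap ℂ V W) (v) :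
    coordMultilinear μ v = coordEquiv W (μ fun b => (coordEquiv (V b)).symm (v b)) := rfl

lemma continuous_coordMultilinear (μ : MultilinearMap ℂ V W) (hμ : Continuous μ) :
    Continuous (coordMultilinear μ) := by
  rw [funext (coordMultilinear_apply μ)]
  exact (coordEquiv W).continuous.comp (hμ.comp (continuous_pi fun b =>
    (coordEquiv (V b)).symm.continuous.comp (continuous_apply b)))

lemma coordMultilinear_ne_zero (μ : MultilinearMap ℂ V W)
    (hne : ∀ v, (∀ b, v b ≠ 0) → μ v ≠ 0) (v) (hv : ∀ b, v b ≠ 0) : coordMultilinear μ v ≠ 0 := by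
  rw [coordMultilinear_apply]
  simpa using hne _ fun b => by simpa using hv b

lemma coordMultilinear_image (μ : MultilinearMap ℂ V W) (O : ∀ b, Set (V b)) :
    coordMultilinear μ '' (Set.univ.pi fun b => coordEquiv (V b) '' O b) =
      coordEquiv W '' (μ '' Set.univ.pi O) := by
  ext w
  constructor
  · rintro ⟨v, hv, rfl⟩
    refine ⟨_, ⟨_, fun b _ => ?_, rfl⟩, (coordMultilinear_apply μ v).symm⟩
    obtain ⟨u, hu, h⟩ := hv b trivial
    simp only [← h, ContinuousLinearEquiv.symm_apply_apply]
    exact hu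
  · rintro ⟨_, ⟨v, hv, rfl⟩, rfl⟩
    refine ⟨fun b => coordEquiv (V b) (v b), fun b _ => ⟨v b, hv b trivial, rfl⟩, ?_⟩
    simp only [coordMultilinear_apply, ContinuousLinearEquiv.symm_apply_apply]

/-- A multilinear map without zeros maps products of sets away from `0` to a set away from `0`. -/
lemma zero_notMem_closure_image_multilinear' [Fintype β] (μ : MultilinearMap ℂ V W)
    (hμ : Continuous μ) (hne : ∀ v, (∀ b, v b ≠ 0) → μ v ≠ 0)
    (O : ∀ b, Set (V b)) (hO : ∀ b, (0 : V b) ∉ closure (O b)) :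
    (0 : W) ∉ closure (μ '' Set.univ.pi O) := by
  have := zero_notMem_closure_image_multilinear (coordMultilinear μ)
    (continuous_coordMultilinear μ hμ) (coordMultilinear_ne_zero μ hne)
    (fun b => coordEquiv (V b) '' O b) fun b => by
      rw [← ContinuousLinearEquiv.image_closure]
      rintro ⟨u, hu, h⟩
      rw [ContinuousLinearEquiv.map_eq_zero_iff] at h
      exact hO b (h ▸ hu)
  rw [coordMultilinear_image, ← ContinuousLinearEquiv.image_closure] at this
  exact fun h => this ⟨0, h, map_zero _⟩

/-- A multilinear map without zeros maps products of closed sets that avoid `0` to closed sets. -/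
lemma isClosed_image_multilinear' [Fintype β] (μ : MultilinearMap ℂ V W) (hμ : Continuous μ)
    (hne : ∀ v, (∀ b, v b ≠ 0) → μ v ≠ 0)
    (O : ∀ b, Set (V b)) (hcl : ∀ b, IsClosed (O b)) (hO : ∀ b, (0 : V b) ∉ O b) :
    IsClosed (μ '' Set.univ.pi O) := by
  have := isClosed_image_multilinear (coordMultilinear μ)
    (continuous_coordMultilinear μ hμ) (coordMultilinear_ne_zero μ hne)
    (fun b => coordEquiv (V b) '' O b)
    (fun b => (coordEquiv (V b)).toHomeomorph.isClosedMap _ (hcl b)) fun b => by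
      rintro ⟨u, hu, h⟩
      rw [ContinuousLinearEquiv.map_eq_zero_iff] at h
      exact hO b (h ▸ hu)
  rw [coordMultilinear_image] at this
  exact ((coordEquiv W).toHomeomorph.isClosed_image).1 this

end Multilinear

/-! ### The topology of the space of forms -/

section FormTopology

variable {σ : Type*} {m : ℕ}

/-- The coefficients of a form, as a linear map. -/
def formCoeff (σ : Type*) (m : ℕ) : Form σ m →ₗ[ℂ] ((σ →₀ ℕ) → ℂ) where
  toFun f d := MvPolynomial.coeff d (f : MvPolynomial σ ℂ)
  map_add' _ _ := by ext d; simp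
  map_smul' _ _ := by ext d; simp

lemma formCoeff_injective : Function.Injective (formCoeff σ m) := fun _ _ h =>
  Subtype.ext (MvPolynomial.ext _ _ fun d => congrFun h d)

instance : IsTopologicalAddGroup (Form σ m) :=
  topologicalAddGroup_induced (formCoeff σ m)

instance : ContinuousSMul ℂ (Form σ m) :=
  continuousSMul_induced (formCoeff σ m)

lemma continuous_formCoeff : Continuous (formCoeff σ m) := continuous_induced_dom

instance : T2Space (Form σ m) :=
  T2Space.of_injective_continuous formCoeff_injective continuous_formCoeff

instance [Finite σ] : FiniteDimensional ℂ (Form σ m) :=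
  Module.Finite.iff_fg.2 (MvPolynomial.homogeneousSubmodule_fg σ ℂ m)

/-- A family of polynomials whose coefficients depend continuously on the parameter. -/
def CoeffContinuous {X : Type*} [TopologicalSpace X] (p : X → MvPolynomial σ ℂ) : Prop :=
  ∀ d, Continuous fun x => MvPolynomial.coeff d (p x)

namespace CoeffContinuous

variable {X : Type*} [TopologicalSpace X] {p q : X → MvPolynomial σ ℂ}

lemma const (f : MvPolynomial σ ℂ) : CoeffContinuous fun _ : X => f := fun _ => continuous_const

lemma add (hp : CoeffContinuous p) (hq : CoeffContinuous q) :
    CoeffContinuous fun x => p x + q x := fun d => by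
  simp only [MvPolynomial.coeff_add]
  exact (hp d).add (hq d)

lemma mul (hp : CoeffContinuous p) (hq : CoeffContinuous q) :
    CoeffContinuous fun x => p x * q x := fun d => by
  classical
  simp only [MvPolynomial.coeff_mul]
  exact continuous_finsetSum _ fun e _ => (hp _).mul (hq _)

lemma C {a : X → ℂ} (ha : Continuous a) :
    CoeffContinuous fun x => (MvPolynomial.C (a x) : MvPolynomial σ ℂ) := fun d => by
  classical
  simp only [MvPolynomial.coeff_C]
  split_ifs
  · exact ha
  · exact continuous_const

lemma sum {ι : Type*} (s : Finset ι) {p : ι → X → MvPolynomial σ ℂ}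
    (hp : ∀ i ∈ s, CoeffContinuous (p i)) : CoeffContinuous fun x => ∑ i ∈ s, p i x := by
  classical
  induction s using Finset.induction_on with
  | empty => simpa using const (X := X) (0 : MvPolynomial σ ℂ)
  | insert i s hi ih =>
    simp only [Finset.sum_insert hi]
    exact (hp i (Finset.mem_insert_self _ _)).add
      (ih fun j hj => hp j (Finset.mem_insert_of_mem hj))

lemma prod {ι : Type*} (s : Finset ι) {p : ι → X → MvPolynomial σ ℂ}
    (hp : ∀ i ∈ s, CoeffContinuous (p i)) : CoeffContinuous fun x => ∏ i ∈ s, p i x := by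
  classical
  induction s using Finset.induction_on with
  | empty => simpa using const (X := X) (1 : MvPolynomial σ ℂ)
  | insert i s hi ih =>
    simp only [Finset.prod_insert hi]
    exact (hp i (Finset.mem_insert_self _ _)).mul
      (ih fun j hj => hp j (Finset.mem_insert_of_mem hj))

lemma continuous {F : X → Form σ m} (h : CoeffContinuous fun x => (F x : MvPolynomial σ ℂ)) :
    Continuous F :=
  continuous_induced_rng.2 (continuous_pi h)

/-- A linear function of a form has coefficients that depend continuously on the form. -/
lemma of_linear [Finite σ] {τ : Type*} (L : Form σ m →ₗ[ℂ] MvPolynomial τ ℂ) :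
    CoeffContinuous L := fun d =>
  LinearMap.continuous_of_finiteDimensional ((MvPolynomial.lcoeff ℂ d).comp L)

end CoeffContinuous

end FormTopology

/-! ### The action on forms -/

section Action

variable {σ : Type*} [Fintype σ]

lemma coeffContinuous_substLinear (f : MvPolynomial σ ℂ) :
    CoeffContinuous fun A : Matrix σ σ ℂ => substLinear A f := by
  induction f using MvPolynomial.induction_on with
  | C a => simpa [substLinear] using CoeffContinuous.const (MvPolynomial.C a)
  | add p q hp hq => simpa using hp.add hq
  | mul_X p i hp =>
    simp only [map_mul]
    refine hp.mul ?_
    simp only [substLinear, MvPolynomial.aeval_X]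
    exact CoeffContinuous.sum _ fun k _ =>
      (CoeffContinuous.C ((continuous_apply k).comp (continuous_apply i))).mul
        (CoeffContinuous.const _)

variable [DecidableEq σ]

lemma formRep_coe {m : ℕ} (g : Matrix.SpecialLinearGroup σ ℂ) (f : Form σ m) :
    ((formRep σ m g f : Form σ m) : MvPolynomial σ ℂ) =
      substLinear ((g⁻¹ : Matrix.SpecialLinearGroup σ ℂ) : Matrix σ σ ℂ) f := rfl

lemma continuous_formRep (m : ℕ) :
    Continuous fun p : Matrix.SpecialLinearGroup σ ℂ × Form σ m => formRep σ m p.1 p.2 := by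
  have h1 : ∀ f : Form σ m, Continuous fun g => formRep σ m g f := fun f => by
    refine CoeffContinuous.continuous fun d => ?_
    simp only [formRep_coe]
    exact (coeffContinuous_substLinear f.1 d).comp (continuous_subtype_val.comp continuous_inv)
  let e := Module.finBasis ℂ (Form σ m)
  have h2 : ∀ p : Matrix.SpecialLinearGroup σ ℂ × Form σ m,
      formRep σ m p.1 p.2 = ∑ k, e.repr p.2 k • formRep σ m p.1 (e k) := fun p => by
    conv_lhs => rw [← e.sum_repr p.2, map_sum]
    simp only [map_smul]
  simp only [h2]
  refine continuous_finsetSum _ fun k _ => ?_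
  exact ((LinearMap.continuous_of_finiteDimensional (e.coord k)).comp continuous_snd).smul
    ((h1 _).comp continuous_fst)

instance : SigmaCompactSpace (Matrix.SpecialLinearGroup σ ℂ) := by
  have : SigmaCompactSpace (Matrix σ σ ℂ) := inferInstanceAs (SigmaCompactSpace (σ → σ → ℂ))
  exact Matrix.SpecialLinearGroup.isClosedEmbedding_val.sigmaCompactSpace

end Action

/-! ### Linear forms -/

section LinForm

variable {σ : Type*} [Fintype σ]

lemma linForm_smul (c : ℂ) (v : σ → ℂ) : linForm (c • v) = MvPolynomial.C c * linForm v := by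
  simp [linForm, Finset.mul_sum, mul_assoc]

lemma linForm_add (v w : σ → ℂ) : linForm (v + w) = linForm v + linForm w := by
  simp [linForm, add_mul, Finset.sum_add_distrib]

lemma coeff_linForm (v : σ → ℂ) (i : σ) :
    MvPolynomial.coeff (Finsupp.single i 1) (linForm v) = v i := by
  classical
  simp [linForm, MvPolynomial.coeff_sum, MvPolynomial.coeff_C_mul, MvPolynomial.coeff_X,
    Finsupp.single_left_inj]

lemma linForm_injective : Function.Injective (linForm (σ := σ)) := fun v w h => by
  ext i
  have := congrArg (MvPolynomial.coeff (Finsupp.single i 1)) h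
  rwa [coeff_linForm, coeff_linForm] at this

lemma linForm_ne_zero {v : σ → ℂ} (hv : v ≠ 0) : linForm v ≠ 0 := fun h =>
  hv (linForm_injective (h.trans (by simp [linForm])))

lemma linForm_isHomogeneous (v : σ → ℂ) : (linForm v).IsHomogeneous 1 :=
  MvPolynomial.IsHomogeneous.sum _ _ _ fun _ _ => MvPolynomial.isHomogeneous_C_mul_X _ _

lemma irreducible_linForm {v : σ → ℂ} (hv : v ≠ 0) : Irreducible (linForm v) := by
  refine MvPolynomial.irreducible_of_totalDegree_eq_one
    ((linForm_isHomogeneous v).totalDegree (linForm_ne_zero hv)) fun x hx => ?_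
  obtain ⟨i, hi⟩ := Function.ne_iff.1 hv
  have := hx (Finsupp.single i 1)
  rw [coeff_linForm] at this
  exact (ne_zero_of_dvd_ne_zero hi this).isUnit

/-- A linear form that divides a product of linear forms is proportional to a factor. -/
lemma exists_smul_of_linForm_dvd_prod {κ : Type*} [Fintype κ] {v : σ → ℂ} (hv : v ≠ 0)
    {w : κ → σ → ℂ} (hw : ∀ k, w k ≠ 0) (h : linForm v ∣ ∏ k, linForm (w k)) :
    ∃ k, ∃ c : ℂ, v = c • w k := by
  obtain ⟨k, -, hk⟩ := (irreducible_linForm hv).prime.exists_mem_finset_dvd h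
  refine ⟨k, ?_⟩
  obtain ⟨u, hu⟩ := (irreducible_linForm hv).dvd_symm (irreducible_linForm (hw k)) hk
  obtain ⟨c, hc⟩ : ∃ c : ℂ, u = MvPolynomial.C c := by
    have hu0 : u ≠ 0 := fun h0 => linForm_ne_zero hv (by rw [hu, h0, mul_zero])
    have h1 := congrArg MvPolynomial.totalDegree hu
    rw [MvPolynomial.totalDegree_mul_of_isDomain (linForm_ne_zero (hw k)) hu0,
      (linForm_isHomogeneous _).totalDegree (linForm_ne_zero hv),
      (linForm_isHomogeneous _).totalDegree (linForm_ne_zero (hw k))] at h1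
    exact ⟨_, MvPolynomial.totalDegree_eq_zero_iff_eq_C.1 (by omega)⟩
  refine ⟨c, linForm_injective ?_⟩
  rw [hu, hc, linForm_smul, mul_comm]

open Matrix in
lemma substLinear_linForm (A : Matrix σ σ ℂ) (v : σ → ℂ) :
    substLinear A (linForm v) = linForm (v ᵥ* A) := by
  simp only [linForm, substLinear, map_sum, map_mul, MvPolynomial.aeval_X, MvPolynomial.algHom_C,
    MvPolynomial.algebraMap_eq, vecMul, dotProduct, Finset.sum_mul, Finset.mul_sum]
  rw [Finset.sum_comm]
  simp [mul_assoc]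

end LinForm

/-! ### Block diagonal matrices with respect to a basis -/

section Block

set_option linter.unusedSectionVars false

open Matrix

lemma det_blockDiagonal_sigma {β : Type*} [Fintype β] [DecidableEq β] {D : β → ℕ}
    (A : ∀ b, Matrix (Fin (D b)) (Fin (D b)) ℂ) :
    (blockDiagonal' A).det = ∏ b, (A b).det := by
  let e := Fintype.equivFin β
  have ht : BlockTriangular (blockDiagonal' A) fun i => e i.1 := by
    intro i j hij
    rw [blockDiagonal'_apply, dif_neg]
    rintro h
    simp [h] at hij
  rw [ht.det_fintype, ← e.prod_comp]
  refine Finset.prod_congr rfl fun b _ => ?_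
  let f : Fin (D b) ≃ {i : Σ b, Fin (D b) // e i.1 = e b} :=
    { toFun := fun a => ⟨⟨b, a⟩, rfl⟩
      invFun := fun i => (e.injective i.2) ▸ i.1.2
      left_inv := fun a => rfl
      right_inv := by
        rintro ⟨⟨b', a⟩, h⟩
        obtain rfl := e.injective h
        rfl }
  rw [← det_submatrix_equiv_self f]
  congr 1
  ext a a'
  simp [f, toSquareBlock_def, blockDiagonal'_apply_eq]

variable {σ β : Type*} [Fintype σ] [DecidableEq σ] [Fintype β] [DecidableEq β] {D : β → ℕ}
  (B : Module.Basis (Σ b, Fin (D b)) ℂ (σ → ℂ))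

/-- The matrix whose rows are the vectors of a basis. -/
def rowMatrix : Matrix (Σ b, Fin (D b)) σ ℂ := Matrix.of fun i => B i

/-- The inverse of `rowMatrix`: its rows are the coordinates of the standard basis vectors. -/
def rowMatrixInv : Matrix σ (Σ b, Fin (D b)) ℂ := Matrix.of fun k i => B.repr (Pi.single k 1) i

lemma vecMul_rowMatrixInv (v : σ → ℂ) : v ᵥ* rowMatrixInv B = B.repr v := by
  ext i
  conv_rhs => rw [← Finset.univ_sum_single v]
  simp only [map_sum, vecMul, dotProduct, rowMatrixInv, of_apply, Finsupp.finsetSum_apply]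
  refine Finset.sum_congr rfl fun k _ => ?_
  have : (Pi.single k (v k) : σ → ℂ) = v k • Pi.single k 1 := by
    rw [← Pi.single_smul, smul_eq_mul, mul_one]
  rw [this, map_smul, Finsupp.smul_apply, smul_eq_mul]

lemma vecMul_rowMatrix (c : (Σ b, Fin (D b)) → ℂ) : c ᵥ* rowMatrix B = ∑ i, c i • B i := by
  ext k
  simp [vecMul, dotProduct, rowMatrix]

lemma rowMatrix_mul_rowMatrixInv : rowMatrix B * rowMatrixInv B = 1 := by
  ext i j
  have := congrFun (vecMul_rowMatrixInv B (B i)) j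
  rw [B.repr_self] at this
  rw [Matrix.one_apply]
  change (B i ᵥ* rowMatrixInv B) j = _
  rw [this, Finsupp.single_apply]

lemma rowMatrixInv_mul_rowMatrix : rowMatrixInv B * rowMatrix B = 1 := by
  refine Matrix.ext_of_single_vecMul fun k => ?_
  rw [← vecMul_vecMul, vecMul_rowMatrixInv, vecMul_rowMatrix, B.sum_repr, vecMul_one]

/-- The matrix that is block diagonal, with given blocks, in a basis indexed by a sigma type; as
everywhere below, matrices act on row vectors from the right. -/
def blk : (∀ b, Matrix (Fin (D b)) (Fin (D b)) ℂ) →+* Matrix σ σ ℂ where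
  toFun A := rowMatrixInv B * blockDiagonal' A * rowMatrix B
  map_one' := by
    rw [blockDiagonal'_one, Matrix.mul_one, rowMatrixInv_mul_rowMatrix]
  map_mul' A A' := by
    have : blockDiagonal' (A * A') = blockDiagonal' A * blockDiagonal' A' :=
      blockDiagonal'_mul A A'
    rw [this]
    simp only [Matrix.mul_assoc]
    rw [← Matrix.mul_assoc (rowMatrix B) (rowMatrixInv B), rowMatrix_mul_rowMatrixInv,
      Matrix.one_mul]
  map_zero' := by
    rw [blockDiagonal'_zero, Matrix.mul_zero, Matrix.zero_mul]
  map_add' A A' := by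
    rw [blockDiagonal'_add, Matrix.mul_add, Matrix.add_mul]

lemma blk_apply (A : ∀ b, Matrix (Fin (D b)) (Fin (D b)) ℂ) :
    blk B A = rowMatrixInv B * blockDiagonal' A * rowMatrix B := rfl

/-- The diagonal blocks of a matrix in a basis indexed by a sigma type. -/
def blkPart (M : Matrix σ σ ℂ) (b : β) : Matrix (Fin (D b)) (Fin (D b)) ℂ :=
  blockDiag' (rowMatrix B * M * rowMatrixInv B) b

lemma blkPart_blk (A : ∀ b, Matrix (Fin (D b)) (Fin (D b)) ℂ) : blkPart B (blk B A) = A := by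
  funext b
  have : rowMatrix B * blk B A * rowMatrixInv B = blockDiagonal' A := by
    rw [blk_apply]
    simp only [Matrix.mul_assoc]
    rw [rowMatrix_mul_rowMatrixInv, Matrix.mul_one, ← Matrix.mul_assoc,
      rowMatrix_mul_rowMatrixInv, Matrix.one_mul]
  rw [blkPart, this, blockDiag'_blockDiagonal']

lemma blk_injective : Function.Injective (blk B) :=
  Function.LeftInverse.injective (blkPart_blk B)

lemma det_blk (A : ∀ b, Matrix (Fin (D b)) (Fin (D b)) ℂ) : (blk B A).det = ∏ b, (A b).det := by
  rw [blk_apply, det_conj_of_mul_eq_one (rowMatrixInv_mul_rowMatrix B)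
    (rowMatrix_mul_rowMatrixInv B), det_blockDiagonal_sigma]

lemma continuous_blk : Continuous (blk B) := by
  change Continuous fun A : ∀ b, Matrix (Fin (D b)) (Fin (D b)) ℂ =>
    rowMatrixInv B * blockDiagonal' A * rowMatrix B
  exact (continuous_const.matrix_mul (continuous_id.matrix_blockDiagonal')).matrix_mul
    continuous_const

lemma basis_vecMul_blk (A : ∀ b, Matrix (Fin (D b)) (Fin (D b)) ℂ) (b : β) (a : Fin (D b)) :
    B ⟨b, a⟩ ᵥ* blk B A = ∑ a', A b a a' • B ⟨b, a'⟩ := by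
  rw [blk_apply, ← vecMul_vecMul, ← vecMul_vecMul, vecMul_rowMatrixInv, vecMul_rowMatrix,
    B.repr_self, Finsupp.single_eq_pi_single, single_one_vecMul, Fintype.sum_sigma]
  rw [Finset.sum_eq_single b]
  · simp [blockDiagonal'_apply_eq]
  · intro b' _ hb
    refine Finset.sum_eq_zero fun a' _ => ?_
    simp [row, blockDiagonal'_apply_ne _ _ _ hb.symm]
  · simp

lemma matrix_ext_basis {M N : Matrix σ σ ℂ} (h : ∀ i, B i ᵥ* M = B i ᵥ* N) : M = N := by
  have : M.vecMulLinear = N.vecMulLinear := B.ext h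
  refine Matrix.ext_of_single_vecMul fun k => ?_
  exact LinearMap.congr_fun this _

lemma eq_blk_iff {M : Matrix σ σ ℂ} {A : ∀ b, Matrix (Fin (D b)) (Fin (D b)) ℂ} :
    M = blk B A ↔ ∀ b a, B ⟨b, a⟩ ᵥ* M = ∑ a', A b a a' • B ⟨b, a'⟩ := by
  constructor
  · rintro rfl b a
    exact basis_vecMul_blk B A b a
  · intro h
    refine matrix_ext_basis B fun i => ?_
    rw [show i = ⟨i.1, i.2⟩ from rfl, h, basis_vecMul_blk]

lemma eq_blk_of_repr_eq_zero {M : Matrix σ σ ℂ}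
    (h : ∀ i j : Σ b, Fin (D b), i.1 ≠ j.1 → B.repr (B i ᵥ* M) j = 0) :
    ∃ A, M = blk B A := by
  refine ⟨fun b a a' => B.repr (B ⟨b, a⟩ ᵥ* M) ⟨b, a'⟩, (eq_blk_iff B).2 fun b a => ?_⟩
  conv_lhs => rw [← B.sum_repr (B ⟨b, a⟩ ᵥ* M), Fintype.sum_sigma]
  rw [Finset.sum_eq_single b]
  · intro b' _ hb
    exact Finset.sum_eq_zero fun a' _ => by rw [h ⟨b, a⟩ ⟨b', a'⟩ hb.symm, zero_smul]
  · simp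

/-- The matrix that is scalar on each block. -/
def blkScalar (l : β → ℂ) : Matrix σ σ ℂ := blk B fun b => l b • 1

lemma basis_vecMul_blkScalar (l : β → ℂ) (i) : B i ᵥ* blkScalar B l = l i.1 • B i := by
  obtain ⟨b, a⟩ := i
  rw [blkScalar, basis_vecMul_blk]
  simp [Matrix.one_apply]

lemma eq_blkScalar_iff {M : Matrix σ σ ℂ} {l : β → ℂ} :
    M = blkScalar B l ↔ ∀ i, B i ᵥ* M = l i.1 • B i := by
  constructor
  · rintro rfl i
    exact basis_vecMul_blkScalar B l i
  · intro h
    refine matrix_ext_basis B fun i => ?_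
    rw [h, basis_vecMul_blkScalar]

lemma det_blkScalar (l : β → ℂ) : (blkScalar B l).det = ∏ b, l b ^ D b := by
  rw [blkScalar, det_blk]
  simp

lemma blkScalar_mul (l l' : β → ℂ) :
    blkScalar B (fun b => l b * l' b) = blkScalar B l * blkScalar B l' := by
  rw [blkScalar, blkScalar, blkScalar, ← map_mul]
  congr 1
  funext b
  simp [smul_smul, mul_comm]

lemma blkScalar_one : blkScalar B (fun _ => 1) = 1 := by
  rw [blkScalar, ← map_one (blk B)]
  congr 1
  funext b
  simp

lemma blkScalar_commute (l : β → ℂ) (A : ∀ b, Matrix (Fin (D b)) (Fin (D b)) ℂ) :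
    blkScalar B l * blk B A = blk B A * blkScalar B l := by
  rw [blkScalar, ← map_mul, ← map_mul]
  congr 1
  funext b
  simp

lemma blkScalar_injective (hD : ∀ b, 0 < D b) : Function.Injective (blkScalar B) := by
  intro l l' h
  funext b
  have := congrFun (blk_injective B h) b
  have := congrFun (congrFun this ⟨0, hD b⟩) ⟨0, hD b⟩
  simpa using this

/-- A matrix that commutes with enough matrices that are scalar on each block preserves the
blocks. -/
lemma eq_blk_of_commute {M : Matrix σ σ ℂ}
    (h : ∀ b b', b ≠ b' → ∃ l : β → ℂ, l b ≠ l b' ∧ M * blkScalar B l = blkScalar B l * M) :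
    ∃ A, M = blk B A := by
  refine eq_blk_of_repr_eq_zero B fun i j hij => ?_
  obtain ⟨l, hl, hM⟩ := h _ _ hij
  have h1 : (B i ᵥ* M) ᵥ* blkScalar B l = l i.1 • (B i ᵥ* M) := by
    rw [vecMul_vecMul, hM, ← vecMul_vecMul, basis_vecMul_blkScalar, smul_vecMul]
  have h2 : (B i ᵥ* M) ᵥ* blkScalar B l = ∑ k, (B.repr (B i ᵥ* M) k * l k.1) • B k := by
    conv_lhs => rw [← B.sum_repr (B i ᵥ* M), sum_vecMul]
    refine Finset.sum_congr rfl fun k _ => ?_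
    rw [smul_vecMul, basis_vecMul_blkScalar, smul_smul]
  have h3 := congrArg (fun v => B.repr v j) (h2.symm.trans h1)
  simp only [B.repr_sum_self, map_smul, Finsupp.smul_apply, smul_eq_mul] at h3
  rw [mul_comm, ← sub_eq_zero, ← sub_mul] at h3
  exact (mul_eq_zero.1 h3).resolve_left (sub_ne_zero.2 hl.symm)

end Block

/-! ### Kernels of primitive characters of tori -/

section Torus

/-- The homomorphism of tori whose coordinates are the Laurent monomials with exponents in the
columns of an integer matrix. -/
def monomialHom {α β : Type*} [Fintype α] (K : Matrix α β ℤ) : (α → ℂˣ) →* (β → ℂˣ) where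
  toFun t b := ∏ a, t a ^ K a b
  map_one' := by ext; simp
  map_mul' s t := by ext; simp [mul_zpow, Finset.prod_mul_distrib]

lemma zpow_finsetSum {G ι : Type*} [CommGroup G] (x : G) (s : Finset ι) (f : ι → ℤ) :
    x ^ ∑ i ∈ s, f i = ∏ i ∈ s, x ^ f i := by
  classical
  induction s using Finset.induction_on with
  | empty => simp
  | insert i s hi ih => rw [Finset.sum_insert hi, Finset.prod_insert hi, zpow_add, ih]

lemma monomialHom_mul {α β γ : Type*} [Fintype α] [Fintype β] (K : Matrix α β ℤ)
    (W : Matrix β γ ℤ) (t : α → ℂˣ) :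
    monomialHom (K * W) t = monomialHom W (monomialHom K t) := by
  funext c
  change ∏ a, t a ^ (K * W) a c = ∏ b, (∏ a, t a ^ K a b) ^ W b c
  have h : ∀ a, t a ^ (K * W) a c = ∏ b, (t a ^ K a b) ^ W b c := fun a => by
    rw [Matrix.mul_apply, zpow_finsetSum]
    exact Finset.prod_congr rfl fun b _ => zpow_mul _ _ _
  simp only [h]
  rw [Finset.prod_comm]
  exact Finset.prod_congr rfl fun b _ => Finset.prod_zpow _ _ _

lemma monomialHom_one {α : Type*} [Fintype α] [DecidableEq α] (t : α → ℂˣ) :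
    monomialHom (1 : Matrix α α ℤ) t = t := by
  funext b
  change ∏ a, t a ^ (1 : Matrix α α ℤ) a b = t b
  rw [Finset.prod_eq_single b]
  · simp
  · intro a _ hab
    simp [hab]
  · simp

/-- The kernel lattice of a primitive vector `e` is a direct summand: `K` is a basis of it, and `W`
is the coordinate map of the projection onto it along `u`. -/
lemma exists_kernel_matrix {β : Type*} [Fintype β] [DecidableEq β] (e u : β → ℤ)
    (hu : ∑ b, u b * e b = 1) :
    ∃ (r : ℕ) (K : Matrix (Fin r) β ℤ) (W : Matrix β (Fin r) ℤ),
      K * W = 1 ∧ (∀ a, ∑ b, K a b * e b = 0) ∧ W * K = 1 - Matrix.vecMulVec e u := by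
  let E : (β → ℤ) →ₗ[ℤ] ℤ := Fintype.linearCombination ℤ e
  have hE : ∀ v, E v = ∑ b, v b * e b := fun v => by
    simp [E, Fintype.linearCombination_apply]
  let bas := Module.finBasis ℤ (LinearMap.ker E)
  have hx : ∀ b, Pi.single b 1 - e b • u ∈ LinearMap.ker E := fun b => by
    rw [LinearMap.mem_ker, map_sub, map_smul, hE u, hu, hE]
    simp [Pi.single_apply]
  refine ⟨_, Matrix.of fun a b => (bas a : β → ℤ) b,
    Matrix.of fun b a => bas.repr ⟨_, hx b⟩ a, ?_, fun a => ?_, ?_⟩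
  · ext a a'
    have h0 : ∑ b, (bas a : β → ℤ) b * e b = 0 := by
      rw [← hE]; exact (bas a).2
    have h1 : ∑ b, (bas a : β → ℤ) b • (⟨_, hx b⟩ : LinearMap.ker E) = bas a := by
      refine Subtype.ext ?_
      funext c
      simp only [AddSubmonoidClass.coe_finsetSum, Finset.sum_apply, SetLike.val_smul,
        Pi.smul_apply, Pi.sub_apply, smul_eq_mul, mul_sub, Finset.sum_sub_distrib,
        ← mul_assoc]
      rw [← Finset.sum_mul, h0]
      simp [Pi.single_apply]
    rw [Matrix.mul_apply, Matrix.one_apply]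
    have h2 := congrArg (fun v => bas.repr v a') h1
    simp only [map_sum, map_smul, Finsupp.finsetSum_apply, Finsupp.smul_apply, smul_eq_mul,
      bas.repr_self, Finsupp.single_apply] at h2
    exact h2
  · simp only [Matrix.of_apply]
    rw [← hE]; exact (bas a).2
  · ext b c
    rw [Matrix.mul_apply]
    have h1 := congrArg (fun v : LinearMap.ker E => (v : β → ℤ) c) (bas.sum_repr ⟨_, hx b⟩)
    simp only [AddSubmonoidClass.coe_finsetSum, Finset.sum_apply, SetLike.val_smul,
        Pi.smul_apply, Pi.sub_apply, smul_eq_mul] at h1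
    refine h1.trans ?_
    simp [Matrix.vecMulVec_apply, Matrix.one_apply, Pi.single_apply, eq_comm]

/-- The kernel of a primitive character of a torus is parametrized by a torus, by Laurent
monomials. -/
lemma exists_monomialHom_range {β : Type*} [Fintype β] [DecidableEq β] (e u : β → ℤ)
    (hu : ∑ b, u b * e b = 1) :
    ∃ (r : ℕ) (K : Matrix (Fin r) β ℤ), Function.Injective (monomialHom K) ∧
      ∀ l : β → ℂˣ, (∃ t, monomialHom K t = l) ↔ ∏ b, l b ^ e b = 1 := by
  obtain ⟨r, K, W, hKW, hKe, hWK⟩ := exists_kernel_matrix e u hu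
  refine ⟨r, K, fun t t' h => ?_, fun l => ⟨?_, fun hl => ⟨monomialHom W l, ?_⟩⟩⟩
  · rw [← monomialHom_one t, ← hKW, monomialHom_mul, h, ← monomialHom_mul, hKW, monomialHom_one]
  · rintro ⟨t, rfl⟩
    have := congrFun (monomialHom_mul K (Matrix.of fun b (_ : Unit) => e b) t) ()
    change _ = ∏ b, monomialHom K t b ^ e b at this
    rw [← this]
    change ∏ a, t a ^ (K * Matrix.of fun b (_ : Unit) => e b) a () = 1
    refine Finset.prod_eq_one fun a _ => ?_
    rw [Matrix.mul_apply]
    simp [hKe a]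
  · rw [← monomialHom_mul, hWK]
    funext c
    change ∏ b, l b ^ ((1 : Matrix β β ℤ) b c - Matrix.vecMulVec e u b c) = l c
    simp only [zpow_sub, Finset.prod_mul_distrib, Finset.prod_inv_distrib, Matrix.vecMulVec_apply,
      zpow_mul]
    rw [Finset.prod_zpow, hl]
    simpa [monomialHom] using congrFun (monomialHom_one l) c

/-- A Laurent monomial as a polynomial in the coordinates of a torus and their inverses. -/
def laurentMonomial {r : ℕ} (k : Fin r → ℤ) : MvPolynomial (Fin r ⊕ Fin r) ℂ :=
  ∏ a, MvPolynomial.X (Sum.inl a) ^ (k a).toNat * MvPolynomial.X (Sum.inr a) ^ (-k a).toNat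

lemma eval_laurentMonomial {r : ℕ} (k : Fin r → ℤ) (t : Fin r → ℂˣ) :
    MvPolynomial.eval (Sum.elim (fun a => (t a : ℂ)) fun a => ((t a)⁻¹ : ℂˣ))
      (laurentMonomial k) = ((∏ a, t a ^ k a : ℂˣ) : ℂ) := by
  rw [laurentMonomial, map_prod, Units.coe_prod]
  refine Finset.prod_congr rfl fun a _ => ?_
  simp only [map_mul, map_pow, MvPolynomial.eval_X, Sum.elim_inl, Sum.elim_inr]
  rw [← Units.val_pow_eq_pow_val, ← Units.val_pow_eq_pow_val, ← Units.val_mul, inv_pow]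
  congr 1
  rcases le_total 0 (k a) with h | h
  · obtain ⟨n, hn⟩ := Int.eq_ofNat_of_zero_le h
    simp [hn]
  · obtain ⟨n, hn⟩ := Int.eq_ofNat_of_zero_le (neg_nonneg.2 h)
    rw [show k a = -(n : ℤ) by omega]
    simp

end Torus

/-! ### Products of special linear groups of the blocks -/

section BlockGroups

set_option linter.unusedSectionVars false

open Matrix

variable {σ β : Type*} [Fintype σ] [DecidableEq σ] [Fintype β] [DecidableEq β] {D : β → ℕ}
  (B : Module.Basis (Σ b, Fin (D b)) ℂ (σ → ℂ))

/-- The product of the special linear groups of the blocks, as block diagonal matrices. -/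
def blockSL : (∀ b, SpecialLinearGroup (Fin (D b)) ℂ) →* SpecialLinearGroup σ ℂ where
  toFun g := ⟨blk B fun b => (g b : Matrix (Fin (D b)) (Fin (D b)) ℂ), by
    rw [det_blk]
    exact Finset.prod_eq_one fun b _ => (g b).2⟩
  map_one' := Subtype.ext (map_one (blk B))
  map_mul' g h := Subtype.ext (map_mul (blk B) (fun b => (g b).1) fun b => (h b).1)

lemma blockSL_coe (g : ∀ b, SpecialLinearGroup (Fin (D b)) ℂ) :
    (blockSL B g : Matrix σ σ ℂ) = blk B fun b => (g b : Matrix (Fin (D b)) (Fin (D b)) ℂ) := rfl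

lemma blockSL_injective : Function.Injective (blockSL B) := fun g h hgh => by
  funext b
  exact Subtype.ext (congrFun (blk_injective B (congrArg Subtype.val hgh)) b)

lemma continuous_blockSL : Continuous (blockSL B) :=
  continuous_induced_rng.2 ((continuous_blk B).comp
    (continuous_pi fun b => continuous_subtype_val.comp (continuous_apply b)))

lemma repr_basis_vecMul (M : Matrix σ σ ℂ) (i j) :
    B.repr (B i ᵥ* M) j = (rowMatrix B * M * rowMatrixInv B) i j := by
  rw [← vecMul_rowMatrixInv]
  rfl

lemma mem_range_blockSL_iff (g : SpecialLinearGroup σ ℂ) :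
    g ∈ (blockSL B).range ↔
      (∀ i j : Σ b, Fin (D b), i.1 ≠ j.1 →
        (rowMatrix B * (g : Matrix σ σ ℂ) * rowMatrixInv B) i j = 0) ∧
      ∀ b, (blkPart B (g : Matrix σ σ ℂ) b).det = 1 := by
  constructor
  · rintro ⟨x, rfl⟩
    refine ⟨fun i j hij => ?_, fun b => ?_⟩
    · rw [← repr_basis_vecMul, blockSL_coe, show i = ⟨i.1, i.2⟩ from rfl, basis_vecMul_blk]
      simp only [map_sum, map_smul, B.repr_self, Finsupp.finsetSum_apply, Finsupp.smul_apply]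
      refine Finset.sum_eq_zero fun a _ => ?_
      rw [Finsupp.single_apply, if_neg, smul_zero]
      rintro rfl
      exact hij rfl
    · rw [blockSL_coe, blkPart_blk]
      exact (x b).2
  · rintro ⟨h1, h2⟩
    obtain ⟨A, hA⟩ := eq_blk_of_repr_eq_zero B (M := (g : Matrix σ σ ℂ)) fun i j hij => by
      rw [repr_basis_vecMul, h1 i j hij]
    rw [hA, blkPart_blk] at h2
    exact ⟨fun b => ⟨A b, h2 b⟩, Subtype.ext hA.symm⟩

lemma isClosed_range_blockSL : IsClosed ((blockSL B).range : Set (SpecialLinearGroup σ ℂ)) := by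
  have hc : Continuous fun g : SpecialLinearGroup σ ℂ =>
      rowMatrix B * (g : Matrix σ σ ℂ) * rowMatrixInv B :=
    (continuous_const.matrix_mul continuous_subtype_val).matrix_mul continuous_const
  have : ((blockSL B).range : Set (SpecialLinearGroup σ ℂ)) =
      (⋂ (i : Σ b, Fin (D b)) (j : Σ b, Fin (D b)) (_ : i.1 ≠ j.1),
        {g : SpecialLinearGroup σ ℂ |
          (rowMatrix B * (g : Matrix σ σ ℂ) * rowMatrixInv B) i j = 0}) ∩
      ⋂ b, {g : SpecialLinearGroup σ ℂ | (blkPart B (g : Matrix σ σ ℂ) b).det = 1} := by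
    ext g
    rw [SetLike.mem_coe, mem_range_blockSL_iff]
    simp
  rw [this]
  refine IsClosed.inter (isClosed_iInter fun i => isClosed_iInter fun j => isClosed_iInter fun _ =>
    isClosed_eq (hc.matrix_elem i j) continuous_const) (isClosed_iInter fun b =>
    isClosed_eq (Continuous.matrix_det ?_) continuous_const)
  exact continuous_matrix fun a a' => hc.matrix_elem ⟨b, a⟩ ⟨b, a'⟩

lemma isConnected_range_blockSL :
    IsConnected ((blockSL B).range : Set (SpecialLinearGroup σ ℂ)) := by
  rw [MonoidHom.coe_range]
  exact isConnected_range (continuous_blockSL B)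

/-- The algebra of polynomial functions of the entries of a matrix. -/
def polyFun (σ : Type*) : Subalgebra ℂ (Matrix σ σ ℂ → ℂ) :=
  (MvPolynomial.aeval (fun (ij : σ × σ) (M : Matrix σ σ ℂ) => M ij.1 ij.2) :
    MvPolynomial (σ × σ) ℂ →ₐ[ℂ] (Matrix σ σ ℂ → ℂ)).range

lemma exists_eval_of_mem_polyFun {F : Matrix σ σ ℂ → ℂ} (h : F ∈ polyFun σ) :
    ∃ p : MvPolynomial (σ × σ) ℂ,
      ∀ M, MvPolynomial.eval (fun ij => M ij.1 ij.2) p = F M := by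
  obtain ⟨p, rfl⟩ := h
  refine ⟨p, fun M => ?_⟩
  induction p using MvPolynomial.induction_on with
  | C a => simp
  | add p q hp hq => simpa using congrArg₂ (· + ·) hp hq
  | mul_X p i hp => simpa using Or.inl hp

lemma conj_entry_mem_polyFun (i j : Σ b, Fin (D b)) :
    (fun M : Matrix σ σ ℂ => (rowMatrix B * M * rowMatrixInv B) i j) ∈ polyFun σ := by
  have : (fun M : Matrix σ σ ℂ => (rowMatrix B * M * rowMatrixInv B) i j) =
      ∑ l, ∑ k, algebraMap ℂ (Matrix σ σ ℂ → ℂ) (rowMatrix B i k * rowMatrixInv B l j) *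
        fun M : Matrix σ σ ℂ => M k l := by
    funext M
    simp only [Finset.sum_apply, Pi.mul_apply, Pi.algebraMap_apply, Algebra.algebraMap_self,
      RingHom.id_apply, Matrix.mul_apply, Finset.sum_mul]
    exact Finset.sum_congr rfl fun l _ => Finset.sum_congr rfl fun k _ => by ring
  rw [this]
  refine sum_mem fun l _ => sum_mem fun k _ => mul_mem (algebraMap_mem _ _) ?_
  exact ⟨MvPolynomial.X (k, l), by simp⟩

lemma isAlgebraic_range_blockSL : IsAlgebraic (blockSL B).range := by
  choose p hp using fun i j => exists_eval_of_mem_polyFun (conj_entry_mem_polyFun B i j)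
  have hdet : ∀ b, (fun M : Matrix σ σ ℂ => (blkPart B M b).det) ∈ polyFun σ := fun b => by
    have : (fun M : Matrix σ σ ℂ => (blkPart B M b).det) =
        ∑ π : Equiv.Perm (Fin (D b)), (Equiv.Perm.sign π : ℤ) • ∏ a, fun M : Matrix σ σ ℂ =>
          (rowMatrix B * M * rowMatrixInv B) ⟨b, π a⟩ ⟨b, a⟩ := by
      funext M
      simp [det_apply', blkPart, blockDiag']
    rw [this]
    exact sum_mem fun π _ => zsmul_mem (prod_mem fun a _ => conj_entry_mem_polyFun B _ _) _
  choose q hq using fun b => exists_eval_of_mem_polyFun (hdet b)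
  refine ⟨{F | (∃ i j : Σ b, Fin (D b), i.1 ≠ j.1 ∧ F = p i j) ∨
    ∃ b, F = q b - MvPolynomial.C 1}, fun g => ?_⟩
  rw [mem_range_blockSL_iff]
  constructor
  · rintro ⟨h1, h2⟩ F (⟨i, j, hij, rfl⟩ | ⟨b, rfl⟩)
    · rw [hp, h1 i j hij]
    · rw [map_sub, hq, h2 b, MvPolynomial.eval_C, sub_self]
  · intro h
    refine ⟨fun i j hij => ?_, fun b => ?_⟩
    · rw [← hp]
      exact h _ (Or.inl ⟨i, j, hij, rfl⟩)
    · have := h _ (Or.inr ⟨b, rfl⟩)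
      rwa [map_sub, hq, MvPolynomial.eval_C, sub_eq_zero] at this

/-! ### Tori of matrices that are scalar on each block -/

/-- The matrices of determinant one that act on the blocks by scalars `l b` with
`∏ b, l b ^ e b = 1`; the exponents `e b` are the sizes of the blocks divided by their greatest
common divisor, so that this group is connected. -/
def scalarTorus (e : β → ℕ) : Subgroup (SpecialLinearGroup σ ℂ) where
  carrier := {g | ∃ l : β → ℂˣ, ∏ b, l b ^ e b = 1 ∧
    (g : Matrix σ σ ℂ) = blkScalar B fun b => (l b : ℂ)}
  one_mem' := ⟨1, by simp, by simpa using (blkScalar_one B).symm⟩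
  mul_mem' := by
    rintro g h ⟨l, hl, hg⟩ ⟨l', hl', hh⟩
    refine ⟨l * l', by simp [mul_pow, Finset.prod_mul_distrib, hl, hl'], ?_⟩
    change (g : Matrix σ σ ℂ) * (h : Matrix σ σ ℂ) = _
    rw [hg, hh, ← blkScalar_mul]
    simp
  inv_mem' := by
    rintro g ⟨l, hl, hg⟩
    refine ⟨l⁻¹, by simp [Finset.prod_inv_distrib, hl], ?_⟩
    have h1 : (g : Matrix σ σ ℂ) * blkScalar B (fun b => ((l⁻¹ : β → ℂˣ) b : ℂ)) = 1 := by
      rw [hg, ← blkScalar_mul, ← blkScalar_one B]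
      simp
    have h2 : (g⁻¹ : SpecialLinearGroup σ ℂ).1 * (g : Matrix σ σ ℂ) = 1 :=
      congrArg Subtype.val (inv_mul_cancel g)
    exact left_inv_eq_right_inv h2 h1

variable {e : β → ℕ} {q : ℕ}

lemma exists_mem_scalarTorus (hq : ∀ b, D b = q * e b) {l : β → ℂˣ} (hl : ∏ b, l b ^ e b = 1) :
    ∃ g ∈ scalarTorus B e, (g : Matrix σ σ ℂ) = blkScalar B fun b => (l b : ℂ) := by
  refine ⟨⟨blkScalar B fun b => (l b : ℂ), ?_⟩, ⟨l, hl, rfl⟩, rfl⟩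
  rw [det_blkScalar]
  have : ∏ b, l b ^ D b = 1 := by
    simp only [hq, mul_comm q, pow_mul, Finset.prod_pow, hl, one_pow]
  simpa using congrArg Units.val this

lemma blkScalar_apply (l : β → ℂ) (j k : σ) :
    blkScalar B l j k = ∑ i, rowMatrixInv B j i * rowMatrix B i k * l i.1 := by
  have : blockDiagonal' (fun b => l b • (1 : Matrix (Fin (D b)) (Fin (D b)) ℂ)) =
      diagonal fun i => l i.1 := by
    rw [← blockDiagonal'_diagonal fun b _ => l b]
    congr 1
    funext b
    rw [smul_one_eq_diagonal]
  rw [blkScalar, blk_apply, this, Matrix.mul_apply]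
  refine Finset.sum_congr rfl fun i _ => ?_
  rw [Matrix.mul_diagonal]
  ring

lemma isTorus_scalarTorus (hD : ∀ b, 0 < D b) (hq : ∀ b, D b = q * e b) (u : β → ℤ)
    (hu : ∑ b, u b * e b = 1) : IsTorus (scalarTorus B e) := by
  obtain ⟨r, K, hinj, hK⟩ := exists_monomialHom_range (fun b => (e b : ℤ)) u hu
  simp only [zpow_natCast] at hK
  have hdet : ∀ t : Fin r → ℂˣ, (blkScalar B fun b => (monomialHom K t b : ℂ)).det = 1 :=
    fun t => by
      obtain ⟨g, -, hg⟩ := exists_mem_scalarTorus B hq ((hK _).1 ⟨t, rfl⟩)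
      rw [← hg, g.2]
  refine ⟨r, ⟨⟨fun t => ⟨blkScalar B fun b => (monomialHom K t b : ℂ), hdet t⟩, ?_⟩, ?_⟩,
    ?_, ?_, ?_⟩
  · exact Subtype.ext (by simpa using blkScalar_one B)
  · intro s t
    refine Subtype.ext ?_
    simp only [map_mul, Pi.mul_apply, Units.val_mul]
    exact blkScalar_mul B _ _
  · intro s t h
    refine hinj (funext fun b => Units.ext ?_)
    exact congrFun (blkScalar_injective B hD (congrArg Subtype.val h)) b
  · intro j k
    refine ⟨∑ i : Σ b, Fin (D b), MvPolynomial.C (rowMatrixInv B j i * rowMatrix B i k) *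
      laurentMonomial fun a => K a i.1, fun t => ?_⟩
    simp only [map_sum, map_mul, eval_laurentMonomial, MvPolynomial.eval_C]
    change blkScalar B _ j k = _
    rw [blkScalar_apply]
    simp [monomialHom]
  · ext g
    constructor
    · rintro ⟨t, rfl⟩
      exact ⟨_, (hK _).1 ⟨t, rfl⟩, rfl⟩
    · rintro ⟨l, hl, hg⟩
      obtain ⟨t, rfl⟩ := (hK l).2 hl
      exact ⟨t, Subtype.ext hg.symm⟩

/-- The weights of the torus on different blocks are different, so its centralizer preserves the
blocks. -/
lemma eq_blk_of_mem_centralizer (he : ∀ b, 0 < e b) (hq : ∀ b, D b = q * e b)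
    {g : SpecialLinearGroup σ ℂ}
    (hg : g ∈ Subgroup.centralizer (scalarTorus B e : Set (SpecialLinearGroup σ ℂ))) :
    ∃ A, (g : Matrix σ σ ℂ) = blk B A := by
  refine eq_blk_of_commute B fun b b' hb => ?_
  let z : ℂˣ := Units.mk0 2 two_ne_zero
  -- the cocharacter of the torus supported on the two blocks
  let l : β → ℂˣ := Function.update (Function.update 1 b (z ^ e b')) b' ((z ^ e b)⁻¹)
  have hl : ∏ c, l c ^ e c = 1 := by
    rw [Finset.prod_eq_mul b b' hb]
    · simp only [l, Function.update_self, Function.update_of_ne hb]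
      rw [inv_pow, ← pow_mul, ← pow_mul, mul_comm, inv_mul_eq_one, mul_comm]
    · intro c _ hc
      simp [l, Function.update_of_ne hc.1, Function.update_of_ne hc.2]
    · simp
    · simp
  obtain ⟨t, ht, htl⟩ := exists_mem_scalarTorus B hq hl
  refine ⟨fun b => (l b : ℂ), ?_, ?_⟩
  · simp only [l, Function.update_self, Function.update_of_ne hb, z]
    simp only [Units.val_pow_eq_pow_val, Units.val_mk0, Units.val_inv_eq_inv_val]
    intro h
    have h1 : (2 : ℂ) ^ (e b' + e b) = 1 := by
      rw [pow_add, h, inv_mul_cancel₀ (pow_ne_zero _ two_ne_zero)]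
    have h2 : (2 : ℕ) ^ (e b' + e b) = 1 := by exact_mod_cast h1
    have := he b
    rw [Nat.pow_eq_one] at h2
    omega
  · rw [← htl]
    exact (congrArg Subtype.val (Subgroup.mem_centralizer_iff.1 hg t ht)).symm

lemma commute_of_mem_scalarTorus {t g : SpecialLinearGroup σ ℂ} (ht : t ∈ scalarTorus B e)
    {A} (hg : (g : Matrix σ σ ℂ) = blk B A) : t * g = g * t := by
  obtain ⟨l, -, hl⟩ := ht
  refine Subtype.ext ?_
  change (t : Matrix σ σ ℂ) * (g : Matrix σ σ ℂ) = (g : Matrix σ σ ℂ) * (t : Matrix σ σ ℂ)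
  rw [hl, hg, blkScalar_commute]

lemma range_blockSL_le_centralizer :
    (blockSL B).range ≤
      Subgroup.centralizer (scalarTorus B e : Set (SpecialLinearGroup σ ℂ)) := by
  rintro _ ⟨x, rfl⟩
  exact Subgroup.mem_centralizer_iff.2 fun t ht =>
    commute_of_mem_scalarTorus B ht (blockSL_coe B x)

/-- Block diagonal matrices of determinant one are products of elements of the special linear groups
of the blocks and of the torus: divide each block by a root of its determinant. The product
`∏ l b ^ e b` of the roots is a `q`-th root of unity, which can be removed by changing the root
at a single block. -/
lemma exists_mul_of_eq_blk [Nonempty β] (hD : ∀ b, 0 < D b) (he : ∀ b, 0 < e b)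
    (hq : ∀ b, D b = q * e b) {g : SpecialLinearGroup σ ℂ} {A} (hg : (g : Matrix σ σ ℂ) = blk B A) :
    ∃ h ∈ (blockSL B).range, ∃ t ∈ scalarTorus B e, g = h * t := by
  have hdet : ∏ b, (A b).det = 1 := by rw [← det_blk B, ← hg, g.2]
  have hne : ∀ b, (A b).det ≠ 0 := fun b h => by
    rw [Finset.prod_eq_zero (Finset.mem_univ b) h] at hdet
    exact zero_ne_one hdet
  choose r hr using fun b => IsAlgClosed.exists_pow_nat_eq (A b).det (hD b)
  let b₀ : β := Classical.arbitrary β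
  obtain ⟨ζ, hζ⟩ := IsAlgClosed.exists_pow_nat_eq (∏ b, r b ^ e b)⁻¹ (he b₀)
  have hω : (∏ b, r b ^ e b) ^ q = 1 := by
    rw [← Finset.prod_pow, ← hdet]
    refine Finset.prod_congr rfl fun b _ => ?_
    rw [← hr, hq, ← pow_mul, mul_comm]
  have hζD : ζ ^ D b₀ = 1 := by
    rw [hq, mul_comm, pow_mul, hζ, inv_pow, hω, inv_one]
  let l : β → ℂ := fun b => if b = b₀ then ζ * r b else r b
  have hlD : ∀ b, l b ^ D b = (A b).det := fun b => by
    simp only [l]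
    split_ifs with h
    · rw [mul_pow, hr, h, hζD, one_mul]
    · exact hr b
  have hl0 : ∀ b, l b ≠ 0 := fun b h => hne b (by rw [← hlD, h, zero_pow (hD b).ne'])
  have hle : ∏ b, l b ^ e b = 1 := by
    have h1 : ∀ b, l b ^ e b = (if b = b₀ then ζ ^ e b₀ else 1) * r b ^ e b := fun b => by
      simp only [l]
      split_ifs with h
      · rw [mul_pow, h]
      · rw [one_mul]
    simp only [h1, Finset.prod_mul_distrib]
    rw [Finset.prod_ite_eq' Finset.univ b₀]
    rw [if_pos (Finset.mem_univ _), hζ, inv_mul_cancel₀]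
    intro h0
    rw [h0] at hω
    rcases Nat.eq_zero_or_pos q with hq0 | hq0
    · have := hq b₀
      rw [hq0, zero_mul] at this
      exact (hD b₀).ne' this
    · rw [zero_pow hq0.ne'] at hω
      exact zero_ne_one hω
  obtain ⟨t, ht, htl⟩ := exists_mem_scalarTorus B hq (l := fun b => Units.mk0 (l b) (hl0 b))
    (Units.ext (by simpa using hle))
  have hdet' : ∀ b, ((l b)⁻¹ • A b).det = 1 := fun b => by
    rw [det_smul, Fintype.card_fin, inv_pow, hlD, inv_mul_cancel₀ (hne b)]
  let x : ∀ b, SpecialLinearGroup (Fin (D b)) ℂ := fun b => ⟨(l b)⁻¹ • A b, hdet' b⟩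
  have hx : (blockSL B x : Matrix σ σ ℂ) = blk B fun b => (l b)⁻¹ • A b := rfl
  have key : (g : Matrix σ σ ℂ) = (blockSL B x : Matrix σ σ ℂ) * (t : Matrix σ σ ℂ) := by
    rw [hx, htl, hg, blkScalar, ← map_mul]
    congr 1
    funext b
    simp [smul_smul, mul_inv_cancel₀ (hl0 b)]
  exact ⟨_, ⟨x, rfl⟩, t, ht, Subtype.ext key⟩

lemma finite_setOf_blkScalar (hD : ∀ b, 0 < D b) :
    {g : SpecialLinearGroup σ ℂ | ∃ l : β → ℂ, (∀ b, l b ^ D b = 1) ∧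
      (g : Matrix σ σ ℂ) = blkScalar B l}.Finite := by
  refine Set.Finite.of_finite_image (f := fun g : SpecialLinearGroup σ ℂ => (g : Matrix σ σ ℂ))
    ?_ Subtype.val_injective.injOn
  have hroot : ∀ b, {z : ℂ | z ^ D b = 1}.Finite := fun b => by
    refine (Polynomial.nthRoots (D b) (1 : ℂ)).toFinset.finite_toSet.subset fun z hz => ?_
    simpa [Polynomial.mem_nthRoots (hD b)] using hz
  refine ((Set.Finite.pi' hroot).image (blkScalar B)).subset ?_
  rintro _ ⟨g, ⟨l, hl, hg⟩, rfl⟩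
  exact ⟨l, hl, hg.symm⟩

lemma finite_range_blockSL_inter_scalarTorus (hD : ∀ b, 0 < D b) :
    (((blockSL B).range : Set (SpecialLinearGroup σ ℂ)) ∩ scalarTorus B e).Finite := by
  refine (finite_setOf_blkScalar B hD).subset ?_
  rintro g ⟨⟨x, hx⟩, l, -, hl⟩
  refine ⟨fun b => l b, fun b => ?_, hl⟩
  rw [← hx, blockSL_coe, blkScalar] at hl
  have := congrArg det (congrFun (blk_injective B hl) b)
  rw [(x b).2, det_smul] at this
  simpa using this.symm

lemma identityComponent_le {G : Type*} [TopologicalSpace G] [Group G] [IsTopologicalGroup G]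
    (K : Subgroup G) : identityComponent K ≤ K := Subgroup.map_subtype_le _

lemma range_le_identityComponent {G G' : Type*} [TopologicalSpace G] [Group G]
    [IsTopologicalGroup G] [TopologicalSpace G'] [Group G'] [ConnectedSpace G'] (f : G' →* G)
    (hf : Continuous f) {K : Subgroup G} (h : f.range ≤ K) : f.range ≤ identityComponent K := by
  rintro _ ⟨x, rfl⟩
  let F : G' → K := fun x => ⟨f x, h ⟨x, rfl⟩⟩
  have hF : Continuous F := continuous_induced_rng.2 hf
  refine ⟨F x, ?_, rfl⟩
  have := (isPreconnected_univ (α := G')).image F hF.continuousOn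
  exact this.subset_connectedComponent ⟨1, trivial, Subtype.ext (map_one f)⟩ ⟨x, trivial, rfl⟩

/-- The product of the special linear groups of the blocks realizes the quotient of the connected
centralizer of the torus by the torus. -/
lemma isLift_range_blockSL [Nonempty β] (hD : ∀ b, 0 < D b) (he : ∀ b, 0 < e b)
    (hq : ∀ b, D b = q * e b) : IsLift (scalarTorus B e) (blockSL B).range where
  algebraic := isAlgebraic_range_blockSL B
  connected := isConnected_range_blockSL B
  le := range_le_identityComponent _ (continuous_blockSL B) (range_blockSL_le_centralizer B)
  surjective z hz := by
    obtain ⟨A, hA⟩ := eq_blk_of_mem_centralizer B he hq (identityComponent_le _ hz)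
    exact exists_mul_of_eq_blk B hD he hq hA
  finite_kernel := finite_range_blockSL_inter_scalarTorus B hD

lemma commutator_pi_eq_top :
    commutator (∀ b, SpecialLinearGroup (Fin (D b)) ℂ) = ⊤ := by
  have h : (⊤ : Subgroup (∀ b, SpecialLinearGroup (Fin (D b)) ℂ)) =
      Subgroup.pi Set.univ fun b => ⊤ := by
    ext x; simp [Subgroup.mem_pi]
  rw [commutator_def, h, Subgroup.commutator_pi_pi_of_finite]
  congr 1
  funext b
  exact commutator_specialLinearGroup_eq_top

/-- The group that realizes the quotient is unique: it contains the commutators of the connected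
centralizer, hence the perfect group `∏ SL` of the blocks, as a closed subgroup of finite index. -/
lemma eq_range_blockSL_of_isLift [Nonempty β] (hD : ∀ b, 0 < D b) (he : ∀ b, 0 < e b)
    (hq : ∀ b, D b = q * e b) {H : Subgroup (SpecialLinearGroup σ ℂ)}
    (hH : IsLift (scalarTorus B e) H) : H = (blockSL B).range := by
  have hle : (blockSL B).range ≤ H := by
    have hcomm : commutator (∀ b, SpecialLinearGroup (Fin (D b)) ℂ) ≤ H.comap (blockSL B) := by
      rw [commutator_def, Subgroup.commutator_le]
      intro x _ y _
      have hmem : ∀ z, blockSL B z ∈ connectedCentralizer (scalarTorus B e) := fun z =>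
        (isLift_range_blockSL B hD he hq).le ⟨z, rfl⟩
      obtain ⟨h, hh, t, ht, hx⟩ := hH.surjective _ (hmem x)
      obtain ⟨h', hh', t', ht', hy⟩ := hH.surjective _ (hmem y)
      have hc : ∀ s ∈ scalarTorus B e, ∀ k ∈ H, s * k = k * s := fun s hs k hk =>
        Subgroup.mem_centralizer_iff.1 (identityComponent_le _ (hH.le hk)) s hs
      have hc' : ∀ s ∈ scalarTorus B e, ∀ z, s * blockSL B z = blockSL B z * s := fun s hs z =>
        commute_of_mem_scalarTorus B hs (blockSL_coe B z)
      have e1 : blockSL B x * blockSL B y = h * blockSL B y * t := by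
        rw [hx, mul_assoc, hc' t ht, mul_assoc]
      have e2 : blockSL B y * blockSL B x = blockSL B y * h * t := by
        rw [hx, mul_assoc]
      have e3 : h * blockSL B y = h * h' * t' := by rw [hy, mul_assoc]
      have e4 : blockSL B y * h = h' * h * t' := by
        rw [hy, mul_assoc, hc t' ht' h hh, mul_assoc]
      rw [Subgroup.mem_comap, commutatorElement_def]
      have : blockSL B (x * y * x⁻¹ * y⁻¹) = h * h' * (h' * h)⁻¹ := by
        have h1 : x * y * x⁻¹ * y⁻¹ = (x * y) * (y * x)⁻¹ := by group
        rw [h1, map_mul, map_inv, map_mul, map_mul, e1, e2, e3, e4]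
        group
      rw [this]
      exact H.mul_mem (H.mul_mem hh hh') (H.inv_mem (H.mul_mem hh' hh))
    rintro _ ⟨x, rfl⟩
    have : x ∈ commutator (∀ b, SpecialLinearGroup (Fin (D b)) ℂ) := by
      rw [commutator_pi_eq_top]; trivial
    exact hcomm this
  -- conversely `H` is connected and a finite union of cosets of the closed subgroup
  refine le_antisymm ?_ hle
  have hcl := isClosed_range_blockSL B
  set S := (blockSL B).range with hS
  -- the complement of `S` in `H` is a finite union of closed cosets
  let F := {t ∈ (H : Set (SpecialLinearGroup σ ℂ)) ∩ scalarTorus B e | t ∉ S}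
  have hF : F.Finite := hH.finite_kernel.subset (Set.sep_subset _ _)
  have hU : IsClosed (⋃ t ∈ F, (fun g => g * t⁻¹) ⁻¹' (S : Set (SpecialLinearGroup σ ℂ))) :=
    hF.isClosed_biUnion fun t _ => hcl.preimage (by fun_prop)
  have hdis : ∀ g ∈ S, g ∉ ⋃ t ∈ F, (fun g => g * t⁻¹) ⁻¹' (S : Set (SpecialLinearGroup σ ℂ)) := by
    intro g hg hg'
    simp only [Set.mem_iUnion, Set.mem_preimage, SetLike.mem_coe, exists_prop] at hg'
    obtain ⟨t, ht, hgt⟩ := hg'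
    refine ht.2 ?_
    have := S.mul_mem (S.inv_mem hgt) hg
    simpa using this
  have hcov : (H : Set (SpecialLinearGroup σ ℂ)) ⊆
      S ∪ ⋃ t ∈ F, (fun g => g * t⁻¹) ⁻¹' (S : Set (SpecialLinearGroup σ ℂ)) := by
    intro g hg
    obtain ⟨A, hA⟩ := eq_blk_of_mem_centralizer B he hq (identityComponent_le _ (hH.le hg))
    obtain ⟨s, hs, t, ht, rfl⟩ := exists_mul_of_eq_blk B hD he hq hA
    have htH : t ∈ H := by
      have := H.mul_mem (H.inv_mem (hle hs)) hg
      simpa using this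
    by_cases htS : t ∈ S
    · exact Or.inl (S.mul_mem hs htS)
    · refine Or.inr ?_
      simp only [Set.mem_iUnion, Set.mem_preimage, SetLike.mem_coe, exists_prop]
      exact ⟨t, ⟨⟨htH, ht⟩, htS⟩, by rwa [mul_inv_cancel_right]⟩
  intro g hg
  by_contra hgS
  have hpre := isPreconnected_closed_iff.1 hH.connected.isPreconnected _ _ hcl hU hcov
    ⟨1, H.one_mem, S.one_mem⟩ ⟨g, hg, (hcov hg).resolve_left hgS⟩
  obtain ⟨x, -, hx1, hx2⟩ := hpre
  exact hdis x hx1 hx2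

end BlockGroups

/-! ### Irreducible decompositions -/

section Irreducible

variable {κ E : Type*} [AddCommGroup E] [Module ℂ E] {P : κ → ℙ ℂ E} {s : ℕ}
  {L : Fin s → Submodule ℂ E}

lemma submodule_le_iff_rep_mem (p : ℙ ℂ E) (W : Submodule ℂ E) : p.submodule ≤ W ↔ p.rep ∈ W := by
  rw [Projectivization.submodule_eq, Submodule.span_singleton_le_iff_mem]

/-- If all points of a configuration are fixed by a linear map, then the eigenspaces of the map give
an orthogonal decomposition; so an irreducible decomposition has at least as many summands as there
are eigenvalues at the points. -/
lemma card_eigenvalues_le (hL : IsIrreducibleDecomposition P L) [Finite κ] (A : Module.End ℂ E)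
    (a : κ → ℂ) (hA : ∀ i, A (P i).rep = a i • (P i).rep) : Nat.card (Set.range a) ≤ s := by
  have : Finite (Set.range a) := Set.finite_range a
  let e : Fin (Nat.card (Set.range a)) ≃ Set.range a := (Finite.equivFin _).symm
  refine hL.2 _ (fun k => ⨆ (i) (_ : a i = e k), (P i).submodule) ⟨?_, ?_, ?_, ?_⟩
  · refine le_antisymm (iSup_le fun k => iSup₂_le fun i _ => le_iSup (fun i => (P i).submodule) i)
      (iSup_le fun i => ?_)
    refine le_iSup_of_le (e.symm ⟨a i, i, rfl⟩) (le_iSup₂_of_le i ?_ le_rfl)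
    rw [e.apply_symm_apply]
  · have hind : iSupIndep fun k => A.eigenspace (e k : ℂ) :=
      A.eigenspaces_iSupIndep.comp (Subtype.val_injective.comp e.injective)
    refine hind.mono fun k => iSup₂_le fun i hi => ?_
    rw [submodule_le_iff_rep_mem, Module.End.mem_eigenspace_iff, hA, hi]
  · intro k
    obtain ⟨i, hi⟩ := (e k).2
    exact ⟨i, le_iSup₂_of_le i hi le_rfl⟩
  · intro i
    refine ⟨e.symm ⟨a i, i, rfl⟩, le_iSup₂_of_le i ?_ le_rfl⟩
    rw [e.apply_symm_apply]

lemma eq_of_submodule_le (hL : IsOrthogonalDecomposition P L) {i : κ} {j k : Fin s}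
    (hj : (P i).submodule ≤ L j) (hk : (P i).submodule ≤ L k) : j = k := by
  by_contra h
  rw [submodule_le_iff_rep_mem] at hj hk
  have : L k ≤ ⨆ (l) (_ : l ≠ j), L l := le_iSup₂_of_le k (Ne.symm h) le_rfl
  exact (P i).rep_nonzero (Submodule.disjoint_def.1 (hL.orthogonal j) _ hj (this hk))

/-- The summands of an orthogonal decomposition are spanned by the points they contain. -/
lemma le_iSup_submodule (hL : IsOrthogonalDecomposition P L) (j : Fin s) :
    L j ≤ ⨆ (i) (_ : (P i).submodule ≤ L j), (P i).submodule := by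
  intro w hw
  have h1 : (⨆ i, (P i).submodule) ≤ (⨆ (i) (_ : (P i).submodule ≤ L j), (P i).submodule) ⊔
      ⨆ (l) (_ : l ≠ j), L l := by
    refine iSup_le fun i => ?_
    obtain ⟨l, hl⟩ := hL.covers i
    rcases eq_or_ne l j with rfl | h
    · exact le_sup_of_le_left (le_iSup₂_of_le i hl le_rfl)
    · exact le_sup_of_le_right (le_iSup₂_of_le l h hl)
  have h2 : w ∈ ⨆ i, (P i).submodule := hL.sum_eq ▸ (le_iSup L j) hw
  obtain ⟨x, hx, y, hy, hxy⟩ := Submodule.mem_sup.1 (h1 h2)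
  have hle : (⨆ (i) (_ : (P i).submodule ≤ L j), (P i).submodule) ≤ L j :=
    iSup₂_le fun i hi => hi
  have hxL : x ∈ L j := hle hx
  have hy0 : y = 0 := by
    refine Submodule.disjoint_def.1 (hL.orthogonal j) y ?_ hy
    have := (L j).sub_mem hw hxL
    rwa [← hxy, add_sub_cancel_left] at this
  rwa [← hxy, hy0, add_zero]

/-- A linear map that fixes all points of a configuration is scalar on the summands of an
irreducible decomposition: otherwise a generic combination of it with a linear map `D` that
separates the summands has more than `s` eigenvalues. -/
lemma exists_scalar_of_irreducible (hL : IsIrreducibleDecomposition P L) [Finite κ]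
    (D : Module.End ℂ E) (hD : ∀ (j : Fin s), ∀ w ∈ L j, D w = (j : ℂ) • w) (A : Module.End ℂ E)
    (hA : ∀ i, ∃ c : ℂ, A (P i).rep = c • (P i).rep) (j : Fin s) :
    ∃ c : ℂ, ∀ w ∈ L j, A w = c • w := by
  choose a ha using hA
  choose k hk using hL.1.covers
  have key : ∀ i i', k i = k i' → a i = a i' := by
    -- the values of `t` for which two points in different summands get the same eigenvalue
    have hbad : (Set.range fun x : κ × κ =>
        (a x.2 - a x.1) / (((k x.1 : ℕ) : ℂ) - ((k x.2 : ℕ) : ℂ))).Finite := Set.finite_range _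
    obtain ⟨t, ht⟩ := hbad.exists_notMem
    let α : κ → ℂ := fun i => t * ((k i : ℕ) : ℂ) + a i
    have hα : ∀ i i', α i = α i' → k i = k i' := by
      intro i i' h
      by_contra hne
      refine ht ⟨(i, i'), ?_⟩
      have h0 : ((k i : ℕ) : ℂ) - ((k i' : ℕ) : ℂ) ≠ 0 := by
        rw [sub_ne_zero]
        exact fun h => hne (Fin.ext (by exact_mod_cast h))
      simp only
      rw [div_eq_iff h0]
      simp only [α] at h
      linear_combination -h
    have hcard := card_eigenvalues_le hL (t • D + A) α fun i => by
      rw [LinearMap.add_apply, LinearMap.smul_apply, ha,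
        hD _ _ ((submodule_le_iff_rep_mem _ _).1 (hk i)), smul_smul, ← add_smul]
    have : Finite (Set.range α) := Set.finite_range α
    let h : Set.range α → Fin s := fun r => k r.2.choose
    have hh : ∀ i, h ⟨α i, i, rfl⟩ = k i := fun i =>
      hα _ _ (Exists.choose_spec (⟨i, rfl⟩ : ∃ i', α i' = α i))
    have hsurj : Function.Surjective h := fun l => by
      obtain ⟨i, hi⟩ := hL.1.meets l
      exact ⟨⟨α i, i, rfl⟩, (hh i).trans (eq_of_submodule_le hL.1 (hk i) hi)⟩
    have hbij := hsurj.bijective_of_nat_card_le (by simpa using hcard)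
    intro i i' hi
    have := congrArg Subtype.val (hbij.1 ((hh i).trans (hi.trans (hh i').symm)))
    simp only [α, hi] at this
    exact add_left_cancel this
  obtain ⟨i₀, hi₀⟩ := hL.1.meets j
  refine ⟨a i₀, fun w hw => ?_⟩
  rw [← Module.End.mem_eigenspace_iff]
  have hle : (⨆ (i) (_ : (P i).submodule ≤ L j), (P i).submodule) ≤ A.eigenspace (a i₀) := by
    refine iSup₂_le fun i hi => ?_
    rw [submodule_le_iff_rep_mem, Module.End.mem_eigenspace_iff, ha,
      key i i₀ ((eq_of_submodule_le hL.1 (hk i) hi).trans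
        (eq_of_submodule_le hL.1 (hk i₀) hi₀).symm)]
  exact hle (le_iSup_submodule hL.1 j hw)

end Irreducible

/-! ### The stabilizer of the line of a configuration form -/

section LineStabilizer

set_option linter.unusedSectionVars false

open Matrix

variable {σ κ : Type*} [Fintype σ] [DecidableEq σ] [Fintype κ] (P : κ → ℙ ℂ (σ → ℂ))

lemma formRep_configForm_coe (g : SpecialLinearGroup σ ℂ) :
    ((formRep σ _ g (configForm P) : Form σ (Fintype.card κ)) : MvPolynomial σ ℂ) =
      ∏ i, linForm ((P i).rep ᵥ* ((g⁻¹ : SpecialLinearGroup σ ℂ) : Matrix σ σ ℂ)) := by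
  rw [formRep_coe, configForm, map_prod]
  exact Finset.prod_congr rfl fun i _ => substLinear_linForm _ _

lemma configForm_ne_zero : configForm P ≠ 0 := fun h => by
  have := congrArg Subtype.val h
  exact Finset.prod_ne_zero_iff.2 (fun i _ => linForm_ne_zero (P i).rep_nonzero) this

lemma vecMul_ne_zero {v : σ → ℂ} (hv : v ≠ 0) (g : SpecialLinearGroup σ ℂ) :
    v ᵥ* (g : Matrix σ σ ℂ) ≠ 0 := fun h => hv <| by
  have h1 : (g : Matrix σ σ ℂ) * ((g⁻¹ : SpecialLinearGroup σ ℂ) : Matrix σ σ ℂ) = 1 :=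
    congrArg Subtype.val (mul_inv_cancel g)
  rw [← vecMul_one v, ← h1, ← vecMul_vecMul, h, zero_vecMul]

/-- The stabilizer of the line of `f_P` permutes the points of `P`, by unique factorization. -/
lemma exists_smul_of_mem_lineStabilizer {g : SpecialLinearGroup σ ℂ}
    (hg : g ∈ lineStabilizer (formRep σ _) (configForm P)) (i : κ) :
    ∃ k, ∃ c : ℂ, (P i).rep ᵥ* (g : Matrix σ σ ℂ) = c • (P k).rep := by
  have hg' := (lineStabilizer (formRep σ _) (configForm P)).inv_mem hg
  obtain ⟨c, hc⟩ := Submodule.mem_span_singleton.1 hg'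
  have h1 := congrArg Subtype.val hc
  rw [formRep_configForm_coe, inv_inv] at h1
  have hv := fun i => vecMul_ne_zero (P i).rep_nonzero g
  refine exists_smul_of_linForm_dvd_prod (hv i) (fun k => (P k).rep_nonzero) ?_
  have h2 : linForm ((P i).rep ᵥ* (g : Matrix σ σ ℂ)) ∣
      MvPolynomial.C c * ∏ k, linForm (P k).rep := by
    have h3 : MvPolynomial.C c * ∏ k, linForm (P k).rep =
        ∏ i, linForm ((P i).rep ᵥ* (g : Matrix σ σ ℂ)) := by
      rw [← h1]
      change _ = c • ∏ k, linForm (P k).rep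
      rw [MvPolynomial.smul_eq_C_mul]
    rw [h3]
    exact Finset.dvd_prod_of_mem _ (Finset.mem_univ i)
  have hc0 : c ≠ 0 := by
    rintro rfl
    rw [zero_smul] at h1
    exact Finset.prod_ne_zero_iff.2 (fun i _ => linForm_ne_zero (hv i)) h1.symm
  refine ((irreducible_linForm (hv i)).prime.dvd_or_dvd h2).resolve_left fun h => ?_
  exact (irreducible_linForm (hv i)).not_isUnit
    (isUnit_of_dvd_unit h ((Ne.isUnit hc0).map MvPolynomial.C))

lemma mem_lineStabilizer_of_smul {g : SpecialLinearGroup σ ℂ}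
    (h : ∀ i, ∃ c : ℂ, (P i).rep ᵥ* (g : Matrix σ σ ℂ) = c • (P i).rep) :
    g ∈ lineStabilizer (formRep σ _) (configForm P) := by
  rw [← inv_mem_iff]
  choose c hc using h
  refine Submodule.mem_span_singleton.2 ⟨∏ i, c i, Subtype.ext ?_⟩
  rw [formRep_configForm_coe, inv_inv]
  change (∏ i, c i) • ∏ k, linForm (P k).rep = _
  rw [MvPolynomial.smul_eq_C_mul, map_prod, ← Finset.prod_mul_distrib]
  exact Finset.prod_congr rfl fun i _ => by rw [hc, linForm_smul]

/-- The line through a point of `P`, moved by a matrix. -/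
def movedLine (g : SpecialLinearGroup σ ℂ) (i : κ) : Submodule ℂ (σ → ℂ) :=
  Submodule.span ℂ {(P i).rep ᵥ* (g : Matrix σ σ ℂ)}

lemma exists_movedLine_eq {g : SpecialLinearGroup σ ℂ}
    (hg : g ∈ lineStabilizer (formRep σ _) (configForm P)) (i : κ) :
    ∃ k, movedLine P g i = movedLine P 1 k := by
  obtain ⟨k, c, h⟩ := exists_smul_of_mem_lineStabilizer P hg i
  refine ⟨k, ?_⟩
  have hc : c ≠ 0 := by
    rintro rfl
    exact vecMul_ne_zero (P i).rep_nonzero g (by rw [h, zero_smul])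
  have h1 : (P k).rep ᵥ* ((1 : SpecialLinearGroup σ ℂ) : Matrix σ σ ℂ) = (P k).rep :=
    vecMul_one _
  rw [movedLine, movedLine, h1, h, Submodule.span_singleton_smul_eq (Ne.isUnit hc)]

lemma exists_smul_of_movedLine_eq {g h : SpecialLinearGroup σ ℂ}
    (hgh : movedLine P g = movedLine P h) (i : κ) :
    ∃ c : ℂ, (P i).rep ᵥ* ((g * h⁻¹ : SpecialLinearGroup σ ℂ) : Matrix σ σ ℂ) = c • (P i).rep := by
  have : (P i).rep ᵥ* (g : Matrix σ σ ℂ) ∈ movedLine P h i := by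
    rw [← hgh]
    exact Submodule.mem_span_singleton_self _
  obtain ⟨c, hc⟩ := Submodule.mem_span_singleton.1 this
  refine ⟨c, ?_⟩
  have h1 : (h : Matrix σ σ ℂ) * ((h⁻¹ : SpecialLinearGroup σ ℂ) : Matrix σ σ ℂ) = 1 :=
    congrArg Subtype.val (mul_inv_cancel h)
  change (P i).rep ᵥ* ((g : Matrix σ σ ℂ) * ((h⁻¹ : SpecialLinearGroup σ ℂ) : Matrix σ σ ℂ)) = _
  rw [← vecMul_vecMul, ← hc, smul_vecMul, vecMul_vecMul, h1, vecMul_one]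

lemma finite_movedLine :
    (movedLine P '' {g | g ∈ lineStabilizer (formRep σ _) (configForm P)}).Finite := by
  refine (Set.Finite.pi' fun _ : κ => Set.finite_range fun k => movedLine P 1 k).subset ?_
  rintro _ ⟨g, hg, rfl⟩ i
  obtain ⟨k, hk⟩ := exists_movedLine_eq P hg i
  exact ⟨k, hk.symm⟩

/-- A group of matrices that permute the points of `P` is finite as soon as its subgroup fixing all
points of `P` is. -/
lemma finite_of_le_lineStabilizer {K : Subgroup (SpecialLinearGroup σ ℂ)}
    (hK : K ≤ lineStabilizer (formRep σ _) (configForm P))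
    (hfin : {g ∈ K | ∀ i, ∃ c : ℂ, (P i).rep ᵥ* (g : Matrix σ σ ℂ) = c • (P i).rep}.Finite) :
    (K : Set (SpecialLinearGroup σ ℂ)).Finite := by
  refine Set.Finite.of_finite_fibers (movedLine P)
    ((finite_movedLine P).subset (Set.image_mono hK)) ?_
  rintro _ ⟨h, hh, rfl⟩
  refine (hfin.image fun g => g * h).subset ?_
  rintro g ⟨hg, hgh⟩
  exact ⟨g * h⁻¹, ⟨K.mul_mem hg (K.inv_mem hh), exists_smul_of_movedLine_eq P hgh⟩, by simp⟩

/-- Some fixed power of every element of the stabilizer of the line of `f_P` fixes all points of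
`P`. -/
lemma exists_pow_fixes : ∃ N : ℕ, 0 < N ∧
    ∀ g ∈ lineStabilizer (formRep σ _) (configForm P), ∀ i,
      ∃ c : ℂ, (P i).rep ᵥ* ((g ^ N : SpecialLinearGroup σ ℂ) : Matrix σ σ ℂ) = c • (P i).rep := by
  let F := movedLine P '' {g | g ∈ lineStabilizer (formRep σ _) (configForm P)}
  have : Finite F := finite_movedLine P
  refine ⟨(Nat.card F).factorial, Nat.factorial_pos _, fun g hg => ?_⟩
  have hpow : ∀ a : ℕ, g ^ a ∈ lineStabilizer (formRep σ _) (configForm P) := fun a =>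
    Subgroup.pow_mem _ hg a
  -- by the pigeonhole principle two of the first powers move the points in the same way
  obtain ⟨a, b, hab, h⟩ : ∃ a b : Fin (Nat.card F + 1), a < b ∧
      movedLine P (g ^ (a : ℕ)) = movedLine P (g ^ (b : ℕ)) := by
    let φ : Fin (Nat.card F + 1) → F := fun a => ⟨movedLine P (g ^ (a : ℕ)), _, hpow a, rfl⟩
    have hφ : ¬ Function.Injective φ := fun hinj => by
      have := Nat.card_le_card_of_injective φ hinj
      simp at this
    simp only [Function.Injective, not_forall] at hφ
    obtain ⟨a, b, h, hne⟩ := hφ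
    rcases lt_or_gt_of_ne hne with hlt | hlt
    · exact ⟨a, b, hlt, congrArg Subtype.val h⟩
    · exact ⟨b, a, hlt, (congrArg Subtype.val h).symm⟩
  have hab' : (a : ℕ) < b := hab
  obtain ⟨c, hc⟩ : (b : ℕ) - a ∣ (Nat.card F).factorial :=
    Nat.dvd_factorial (by omega) (by omega)
  have hfix : ∀ i, ∃ c : ℂ,
      (P i).rep ᵥ* ((g ^ ((b : ℕ) - a) : SpecialLinearGroup σ ℂ) : Matrix σ σ ℂ) =
        c • (P i).rep := by
    have := exists_smul_of_movedLine_eq P h.symm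
    rwa [← pow_sub g hab'.le] at this
  intro i
  obtain ⟨d, hd⟩ := hfix i
  rw [hc, pow_mul]
  refine ⟨d ^ c, ?_⟩
  generalize g ^ ((b : ℕ) - a) = x at hd
  clear hc
  induction c with
  | zero => simp
  | succ c ih =>
    change (P i).rep ᵥ* ((x ^ (c + 1)).1) = _
    rw [pow_succ]
    change (P i).rep ᵥ* ((x ^ c : SpecialLinearGroup σ ℂ).1 * x.1) = _
    rw [← vecMul_vecMul, ih, smul_vecMul, hd, smul_smul, pow_succ]

end LineStabilizer

/-! ### Tori are divisible and diagonalizable -/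

section TorusDiag

open Matrix

/-- The point of affine space with coordinates `t` and `t⁻¹`. -/
abbrev laurentPoint {r : ℕ} (t : Fin r → ℂˣ) : Fin r ⊕ Fin r → ℂ :=
  Sum.elim (fun a => (t a : ℂ)) fun a => ((t a)⁻¹ : ℂˣ)

/-- Clearing denominators in a Laurent polynomial. -/
lemma exists_clear_denominators {r : ℕ} (F : MvPolynomial (Fin r ⊕ Fin r) ℂ) :
    ∃ (N : ℕ) (G : MvPolynomial (Fin r) ℂ), ∀ t : Fin r → ℂˣ,
      MvPolynomial.eval (fun a => (t a : ℂ)) G =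
        (∏ a, (t a : ℂ)) ^ N * MvPolynomial.eval (laurentPoint t) F := by
  induction F using MvPolynomial.induction_on with
  | C c => exact ⟨0, MvPolynomial.C c, fun t => by simp⟩
  | add p q hp hq =>
    obtain ⟨N, G, hG⟩ := hp
    obtain ⟨N', G', hG'⟩ := hq
    refine ⟨N + N', (∏ a, MvPolynomial.X a) ^ N' * G + (∏ a, MvPolynomial.X a) ^ N * G',
      fun t => ?_⟩
    simp only [map_add, map_mul, map_pow, map_prod, MvPolynomial.eval_X, hG, hG']
    ring
  | mul_X p i hp =>
    obtain ⟨N, G, hG⟩ := hp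
    rcases i with a | a
    · refine ⟨N, G * MvPolynomial.X a, fun t => ?_⟩
      simp only [map_mul, MvPolynomial.eval_X, hG, Sum.elim_inl]
      ring
    · refine ⟨N + 1, G * ∏ b ∈ Finset.univ.erase a, MvPolynomial.X b, fun t => ?_⟩
      simp only [map_mul, map_prod, MvPolynomial.eval_X, hG, Sum.elim_inr]
      rw [pow_succ, ← Finset.mul_prod_erase Finset.univ (fun a => (t a : ℂ)) (Finset.mem_univ a)]
      have : (t a : ℂ) * ((t a)⁻¹ : ℂˣ) = 1 := by rw [← Units.val_mul]; simp
      linear_combination -((t a : ℂ) * ∏ b ∈ Finset.univ.erase a, (t b : ℂ)) ^ N *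
        MvPolynomial.eval (laurentPoint t) p * (∏ b ∈ Finset.univ.erase a, (t b : ℂ)) * this

lemma infinite_roots_of_unity : {z : ℂ | ∃ N : ℕ, 0 < N ∧ z ^ N = 1}.Infinite := by
  intro hfin
  have : Finite {z : ℂ | ∃ N : ℕ, 0 < N ∧ z ^ N = 1} := hfin
  obtain ⟨k, hk⟩ : ∃ k, Nat.card {z : ℂ | ∃ N : ℕ, 0 < N ∧ z ^ N = 1} < k := exists_gt _
  have hk0 : 0 < k := by omega
  have hprim := Complex.isPrimitiveRoot_exp k hk0.ne'
  let f : Fin k → {z : ℂ | ∃ N : ℕ, 0 < N ∧ z ^ N = 1} := fun i =>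
    ⟨Complex.exp (2 * Real.pi * Complex.I / k) ^ (i : ℕ), k, hk0, by
      rw [← pow_mul, mul_comm (i : ℕ) k, pow_mul, hprim.pow_eq_one, one_pow]⟩
  have hf : Function.Injective f := fun i j hij =>
    Fin.ext (hprim.pow_inj i.2 j.2 (congrArg Subtype.val hij))
  have := Nat.card_le_card_of_injective f hf
  rw [Nat.card_fin] at this
  omega

/-- Torsion points are dense in a torus: a Laurent polynomial that vanishes at all of them is
zero. -/
lemma eval_laurent_eq_zero_of_torsion {r : ℕ} (F : MvPolynomial (Fin r ⊕ Fin r) ℂ)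
    (h : ∀ t : Fin r → ℂˣ, (∃ N : ℕ, 0 < N ∧ t ^ N = 1) →
      MvPolynomial.eval (laurentPoint t) F = 0) (t : Fin r → ℂˣ) :
    MvPolynomial.eval (laurentPoint t) F = 0 := by
  obtain ⟨N, G, hG⟩ := exists_clear_denominators F
  have hG0 : G = 0 := by
    refine MvPolynomial.funext_set (fun _ => {z : ℂ | ∃ N : ℕ, 0 < N ∧ z ^ N = 1})
      (fun _ => infinite_roots_of_unity) fun x hx => ?_
    choose M hM hxM using fun a => hx a trivial
    have hx0 : ∀ a, x a ≠ 0 := fun a h0 => by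
      have := hxM a
      rw [h0, zero_pow (hM a).ne'] at this
      exact zero_ne_one this
    have := hG fun a => Units.mk0 (x a) (hx0 a)
    rw [h, mul_zero] at this
    · simpa using this
    · refine ⟨∏ a, M a, Finset.prod_pos fun a _ => hM a, funext fun a => Units.ext ?_⟩
      obtain ⟨c, hc⟩ := Finset.dvd_prod_of_mem M (Finset.mem_univ a)
      simp [hc, pow_mul, hxM a]
  have := hG t
  rw [hG0, map_zero] at this
  refine (mul_eq_zero.1 this.symm).resolve_left (pow_ne_zero _ ?_)
  exact Finset.prod_ne_zero_iff.2 fun a _ => (t a).ne_zero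

variable {σ : Type*} [Fintype σ] [DecidableEq σ] {T : Subgroup (SpecialLinearGroup σ ℂ)}

lemma IsTorus.commute (hT : IsTorus T) {s t : SpecialLinearGroup σ ℂ} (hs : s ∈ T) (ht : t ∈ T) :
    s * t = t * s := by
  obtain ⟨r, φ, -, -, rfl⟩ := hT
  obtain ⟨x, rfl⟩ := hs
  obtain ⟨y, rfl⟩ := ht
  rw [← map_mul, mul_comm, map_mul]

lemma IsTorus.exists_pow_eq (hT : IsTorus T) {N : ℕ} (hN : 0 < N) {t : SpecialLinearGroup σ ℂ}
    (ht : t ∈ T) : ∃ s ∈ T, s ^ N = t := by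
  obtain ⟨r, φ, -, -, rfl⟩ := hT
  obtain ⟨x, rfl⟩ := ht
  choose y hy using fun a => IsAlgClosed.exists_pow_nat_eq (x a : ℂ) hN
  have hy0 : ∀ a, y a ≠ 0 := fun a h0 => (x a).ne_zero (by rw [← hy, h0, zero_pow hN.ne'])
  refine ⟨φ fun a => Units.mk0 (y a) (hy0 a), ⟨_, rfl⟩, ?_⟩
  rw [← map_pow]
  congr 1
  funext a
  exact Units.ext (by simpa using hy a)

lemma iSup_eigenspace_eq_top_of_pow_eq_one {E : Type*} [AddCommGroup E] [Module ℂ E]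
    [FiniteDimensional ℂ E] {A : Module.End ℂ E} {N : ℕ} (hN : 0 < N) (hA : A ^ N = 1) :
    ⨆ c, A.maxGenEigenspace c = ⊤ ∧ ∀ c, A.maxGenEigenspace c = A.eigenspace c := by
  have hss : A.IsSemisimple := by
    have hsep : (Polynomial.X ^ N - Polynomial.C (1 : ℂ)).Separable :=
      Polynomial.separable_X_pow_sub_C 1 (by exact_mod_cast hN.ne') one_ne_zero
    refine Module.End.isSemisimple_of_squarefree_aeval_eq_zero hsep.squarefree ?_
    simp [hA]
  have h2 := fun c => hss.isFinitelySemisimple.maxGenEigenspace_eq_eigenspace c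
  refine ⟨?_, h2⟩
  simp only [h2]
  exact hss.iSup_eigenspace_eq_top

/-- Tori are diagonalizable: the elements of finite order are diagonalizable and commute, so they
are simultaneously diagonalizable, and the torsion points are dense. -/
lemma IsTorus.span_eigenvectors_eq_top (hT : IsTorus T) :
    Submodule.span ℂ {v : σ → ℂ | ∀ t ∈ T, ∃ c : ℂ, v ᵥ* (t : Matrix σ σ ℂ) = c • v} = ⊤ := by
  obtain ⟨r, φ, -, hpoly, rfl⟩ := hT
  let ι := {t : Fin r → ℂˣ // ∃ N : ℕ, 0 < N ∧ t ^ N = 1}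
  let f : (Fin r → ℂˣ) → Module.End ℂ (σ → ℂ) := fun t => (φ t : Matrix σ σ ℂ).vecMulLinear
  have hf : ∀ s t, f s * f t = f (t * s) := fun s t => by
    have : (φ (t * s) : Matrix σ σ ℂ) = (φ t : Matrix σ σ ℂ) * (φ s : Matrix σ σ ℂ) :=
      congrArg Subtype.val (map_mul φ t s)
    refine LinearMap.ext fun x => ?_
    simp only [f, Module.End.mul_apply, vecMulLinear_apply, this,
      vecMul_vecMul]
  have hf1 : f 1 = 1 := by
    refine LinearMap.ext fun x => ?_
    have : (φ 1 : Matrix σ σ ℂ) = 1 := congrArg Subtype.val (map_one φ)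
    simp only [f, vecMulLinear_apply, this, vecMul_one, Module.End.one_apply]
  have hfpow : ∀ t (N : ℕ), f t ^ N = f (t ^ N) := fun t N => by
    induction N with
    | zero => rw [pow_zero, pow_zero, hf1]
    | succ N ih => rw [pow_succ, ih, hf, pow_succ, mul_comm]
  have hfin : ∀ t : ι, ⨆ c, (f t.1).maxGenEigenspace c = ⊤ ∧
      ∀ c, (f t.1).maxGenEigenspace c = (f t.1).eigenspace c := fun t => by
    obtain ⟨N, hN, ht⟩ := t.2
    exact iSup_eigenspace_eq_top_of_pow_eq_one hN (by rw [hfpow, ht, hf1])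
  have htop := Module.End.iSup_iInf_maxGenEigenspace_eq_top_of_iSup_maxGenEigenspace_eq_top_of_commute
    (fun t : ι => f t.1) (fun s t _ => by
      change f s.1 * f t.1 = f t.1 * f s.1
      rw [hf, hf, mul_comm]) fun t => (hfin t).1
  rw [eq_top_iff, ← htop]
  refine iSup_le fun χ v hv => Submodule.subset_span ?_
  rintro _ ⟨t, rfl⟩
  by_contra hcon
  have hnot : f t v ∉ Submodule.span ℂ {v} := fun h => by
    obtain ⟨c, hc⟩ := Submodule.mem_span_singleton.1 h
    exact hcon ⟨c, hc.symm⟩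
  obtain ⟨ℓ, hℓ, hker⟩ := Submodule.exists_le_ker_of_notMem hnot
  choose F hF using hpoly
  -- the Laurent polynomial `t ↦ ℓ (v ᵥ* φ t)`
  let Φ : MvPolynomial (Fin r ⊕ Fin r) ℂ :=
    ∑ j, ∑ i, MvPolynomial.C (v i * ℓ (Pi.single j 1)) * F i j
  have hΦ : ∀ t, MvPolynomial.eval (laurentPoint t) Φ = ℓ (f t v) := fun t => by
    have h1 : f t v = ∑ j, (v ᵥ* (φ t : Matrix σ σ ℂ)) j • (Pi.single j 1 : σ → ℂ) := by
      conv_lhs => rw [← Finset.univ_sum_single (f t v)]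
      refine Finset.sum_congr rfl fun j _ => ?_
      rw [← Pi.single_smul, smul_eq_mul, mul_one]
      rfl
    rw [h1]
    simp only [Φ, map_sum, map_mul, map_smul, MvPolynomial.eval_C, ← hF, vecMul, dotProduct,
      smul_eq_mul, Finset.sum_mul]
    exact Finset.sum_congr rfl fun j _ => Finset.sum_congr rfl fun i _ => by ring
  refine hℓ ?_
  rw [← hΦ]
  refine eval_laurent_eq_zero_of_torsion Φ (fun s hs => ?_) t
  rw [hΦ]
  have h1 := (Submodule.mem_iInf _).1 hv ⟨s, hs⟩
  rw [(hfin ⟨s, hs⟩).2, Module.End.mem_eigenspace_iff] at h1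
  have h2 : f s v ∈ Submodule.span ℂ {v} := by
    rw [h1]
    exact Submodule.smul_mem _ _ (Submodule.mem_span_singleton_self v)
  exact hker h2

end TorusDiag

/-! ### Maximal tori of the line stabilizer -/

section MaximalTorus

set_option linter.unusedSectionVars false

open Matrix

variable {σ κ β : Type*} [Fintype σ] [DecidableEq σ] [Fintype κ] [Fintype β] [DecidableEq β]
  {D : β → ℕ}

/-- A basis adapted to a configuration: every point of `P` lies in the span of one block of basis
vectors, and block diagonal matrices that fix all points are scalar on each block. -/
structure IsAdaptedBasis (P : κ → ℙ ℂ (σ → ℂ))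
    (B : Module.Basis (Σ b, Fin (D b)) ℂ (σ → ℂ)) : Prop where
  pos : ∀ b, 0 < D b
  mem : ∀ i, ∃ b, (P i).rep ∈ Submodule.span ℂ (Set.range fun a => B ⟨b, a⟩)
  scalar : ∀ A, (∀ i, ∃ c : ℂ, (P i).rep ᵥ* blk B A = c • (P i).rep) →
    ∃ l, blk B A = blkScalar B l

lemma vecMul_blkScalar_of_mem {B : Module.Basis (Σ b, Fin (D b)) ℂ (σ → ℂ)} {b : β} {v : σ → ℂ}
    (hv : v ∈ Submodule.span ℂ (Set.range fun a => B ⟨b, a⟩)) (l : β → ℂ) :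
    v ᵥ* blkScalar B l = l b • v := by
  induction hv using Submodule.span_induction with
  | mem x hx =>
    obtain ⟨a, rfl⟩ := hx
    exact basis_vecMul_blkScalar B l _
  | zero => simp
  | add x y _ _ hx hy => rw [add_vecMul, hx, hy, smul_add]
  | smul c x _ hx => rw [smul_vecMul, hx, smul_comm]

namespace IsAdaptedBasis

variable {P : κ → ℙ ℂ (σ → ℂ)} {B : Module.Basis (Σ b, Fin (D b)) ℂ (σ → ℂ)}
  (hB : IsAdaptedBasis P B) {e : β → ℕ} {q : ℕ}

include hB

lemma scalarTorus_le : scalarTorus B e ≤ lineStabilizer (formRep σ _) (configForm P) := by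
  rintro t ⟨l, -, ht⟩
  refine mem_lineStabilizer_of_smul P fun i => ?_
  obtain ⟨b, hb⟩ := hB.mem i
  exact ⟨l b, by rw [ht, vecMul_blkScalar_of_mem hb]⟩

/-- A torus of block diagonal matrices that permute the points of `P` fixes the points, because it
is divisible; for the same reason it is contained in the connected group `scalarTorus`. -/
lemma le_scalarTorus (hq : ∀ b, D b = q * e b) (hq0 : 0 < q)
    {T : Subgroup (SpecialLinearGroup σ ℂ)} (hT : IsTorus T)
    (hTP : T ≤ lineStabilizer (formRep σ _) (configForm P))
    (hTB : ∀ t ∈ T, ∃ A, (t : Matrix σ σ ℂ) = blk B A) : T ≤ scalarTorus B e := by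
  intro t ht
  obtain ⟨N, hN, hfix⟩ := exists_pow_fixes P
  obtain ⟨s₁, hs₁, rfl⟩ := hT.exists_pow_eq hq0 ht
  obtain ⟨s₂, hs₂, rfl⟩ := hT.exists_pow_eq hN hs₁
  obtain ⟨A, hA⟩ := hTB _ hs₁
  obtain ⟨l, hl⟩ := hB.scalar A fun i => by
    rw [← hA]
    exact hfix s₂ (hTP hs₂) i
  generalize s₂ ^ N = s at hA hs₁ ht
  have hs : (s : Matrix σ σ ℂ) = blkScalar B l := hA.trans hl
  have hdet : ∏ b, l b ^ D b = 1 := by rw [← det_blkScalar B, ← hs, s.2]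
  have hl0 : ∀ b, l b ≠ 0 := fun b h => by
    rw [Finset.prod_eq_zero (Finset.mem_univ b) (by rw [h, zero_pow (hB.pos b).ne'])] at hdet
    exact zero_ne_one hdet
  have hpow : ∀ k : ℕ, ((s ^ k : SpecialLinearGroup σ ℂ) : Matrix σ σ ℂ) =
      blkScalar B fun b => l b ^ k := fun k => by
    induction k with
    | zero => simpa using (blkScalar_one B).symm
    | succ k ih =>
      rw [pow_succ]
      change ((s ^ k : SpecialLinearGroup σ ℂ) : Matrix σ σ ℂ) * (s : Matrix σ σ ℂ) = _
      rw [ih, hs, ← blkScalar_mul]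
      simp only [pow_succ]
  refine ⟨fun b => Units.mk0 (l b) (hl0 b) ^ q, ?_, ?_⟩
  · simp only [← pow_mul, ← hq]
    exact Units.ext (by simpa using hdet)
  · rw [hpow]
    simp

lemma isMaximalTorus (he : ∀ b, 0 < e b) (hq : ∀ b, D b = q * e b) (hq0 : 0 < q)
    (u : β → ℤ) (hu : ∑ b, u b * e b = 1) :
    IsMaximalTorus (lineStabilizer (formRep σ _) (configForm P)) (scalarTorus B e) := by
  refine ⟨⟨isTorus_scalarTorus B hB.pos hq u hu, hB.scalarTorus_le⟩, ?_⟩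
  rintro T ⟨hT, hTP⟩ hle
  refine hB.le_scalarTorus hq hq0 hT hTP fun t ht => eq_blk_of_mem_centralizer B he hq ?_
  exact Subgroup.mem_centralizer_iff.2 fun s hs => hT.commute (hle hs) ht

lemma eq_scalarTorus (hq : ∀ b, D b = q * e b) (hq0 : 0 < q)
    (u : β → ℤ) (hu : ∑ b, u b * e b = 1) {T : Subgroup (SpecialLinearGroup σ ℂ)}
    (hT : IsMaximalTorus (lineStabilizer (formRep σ _) (configForm P)) T)
    (hTB : ∀ t ∈ T, ∃ A, (t : Matrix σ σ ℂ) = blk B A) : T = scalarTorus B e := by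
  have hle := hB.le_scalarTorus hq hq0 hT.1.1 hT.1.2 hTB
  exact le_antisymm hle
    (hT.2 ⟨isTorus_scalarTorus B hB.pos hq u hu, hB.scalarTorus_le⟩ hle)

lemma configRelativeDatum [Nonempty β] (he : ∀ b, 0 < e b) (hq : ∀ b, D b = q * e b)
    (hq0 : 0 < q) (u : β → ℤ) (hu : ∑ b, u b * e b = 1) :
    ConfigRelativeDatum P (scalarTorus B e) (blockSL B).range :=
  ⟨hB.isMaximalTorus he hq hq0 u hu, isLift_range_blockSL B hB.pos he hq⟩

/-- Elements of `∏ SL` of the blocks that fix all points of `P` are scalar on each block, hence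
there are finitely many of them. -/
lemma finite_range_inf_lineStabilizer :
    (((blockSL B).range ⊓ lineStabilizer (formRep σ _) (configForm P) :
      Subgroup (SpecialLinearGroup σ ℂ)) : Set (SpecialLinearGroup σ ℂ)).Finite := by
  refine finite_of_le_lineStabilizer P inf_le_right ((finite_setOf_blkScalar B hB.pos).subset ?_)
  rintro g ⟨⟨⟨x, rfl⟩, -⟩, hg⟩
  obtain ⟨l, hl⟩ := hB.scalar _ hg
  refine ⟨l, fun b => ?_, hl⟩
  have := congrArg det (congrFun (blk_injective B hl) b)
  rw [(x b).2, det_smul] at this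
  simpa using this.symm

end IsAdaptedBasis

/-- Positive integers are multiples of coprime ones by their greatest common divisor. -/
lemma exists_primitive_exponents [Nonempty β] (hD : ∀ b, 0 < D b) :
    ∃ (e : β → ℕ) (q : ℕ) (u : β → ℤ), (∀ b, 0 < e b) ∧ (∀ b, D b = q * e b) ∧ 0 < q ∧
      ∑ b, u b * e b = 1 := by
  obtain ⟨e, he, hg⟩ := Finset.extract_gcd D (Finset.univ_nonempty (α := β))
  generalize Finset.univ.gcd D = q at he
  have he' : ∀ b, D b = q * e b := fun b => he b (Finset.mem_univ b)
  have hpos : ∀ b, 0 < q ∧ 0 < e b := fun b => by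
    have := hD b
    rw [he' b] at this
    exact ⟨Nat.pos_of_mul_pos_right this, Nat.pos_of_mul_pos_left this⟩
  obtain ⟨u, hu⟩ := Finset.gcd_eq_sum_mul (Finset.univ (α := β)) fun b => (e b : ℤ)
  generalize hd : (Finset.univ.gcd fun b => (e b : ℤ)) = d at hu
  have hd1 : d.natAbs ∣ 1 := by
    rw [← hg]
    refine Finset.dvd_gcd fun b hb => ?_
    rw [← hd]
    simpa using Int.natAbs_dvd_natAbs.2 (Finset.gcd_dvd (f := fun b => (e b : ℤ)) hb)
  have hdd : d * d = 1 := by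
    rw [← Int.natAbs_mul_self, Nat.dvd_one.1 hd1]
    rfl
  refine ⟨e, q, fun b => d * u b, fun b => (hpos b).2, he',
    (hpos (Classical.arbitrary β)).1, ?_⟩
  rw [← hdd]
  nth_rw 3 [hu]
  rw [Finset.mul_sum]
  exact Finset.sum_congr rfl fun b _ => by ring

end MaximalTorus

/-! ### Stability of products -/

section Product

set_option linter.unusedSectionVars false

lemma zero_notMem_orbit {G V : Type*} [Group G] [AddCommGroup V] [Module ℂ V]
    (ρ : Representation ℂ G V) {v : V} (hv : v ≠ 0) : (0 : V) ∉ orbit ρ v := by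
  rintro ⟨g, hg⟩
  refine hv ?_
  have : ρ g⁻¹ (ρ g v) = v := by
    rw [← Module.End.mul_apply, ← map_mul]; simp
  rw [← this]
  change ρ g v = 0 at hg
  rw [hg, map_zero]

variable {β : Type*} [Fintype β] [DecidableEq β] {G V : β → Type*} {W : Type*}
  [∀ b, Group (G b)] [∀ b, TopologicalSpace (G b)] [∀ b, IsTopologicalGroup (G b)]
  [∀ b, SigmaCompactSpace (G b)] [∀ b, T1Space (G b)]
  [∀ b, AddCommGroup (V b)] [∀ b, Module ℂ (V b)]
  [∀ b, TopologicalSpace (V b)] [∀ b, IsTopologicalAddGroup (V b)] [∀ b, ContinuousSMul ℂ (V b)]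
  [∀ b, T2Space (V b)] [∀ b, FiniteDimensional ℂ (V b)] [AddCommGroup W] [Module ℂ W]
  [TopologicalSpace W] [IsTopologicalAddGroup W] [ContinuousSMul ℂ W] [T2Space W]
  [FiniteDimensional ℂ W] {ρ : ∀ b, Representation ℂ (G b) (V b)}
  {ρW : Representation ℂ (∀ b, G b) W} {μ : MultilinearMap ℂ V W} {v : ∀ b, V b}

lemma orbit_multilinear
    (hρ : ∀ g v, ρW g (μ v) = μ fun b => ρ b (g b) (v b)) (v : ∀ b, V b) :
    orbit ρW (μ v) = μ '' Set.univ.pi fun b => orbit (ρ b) (v b) := by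
  ext w
  constructor
  · rintro ⟨g, rfl⟩
    exact ⟨_, fun b _ => ⟨g b, rfl⟩, (hρ g v).symm⟩
  · rintro ⟨x, hx, rfl⟩
    choose g hg using fun b => hx b trivial
    refine ⟨g, (hρ g v).trans ?_⟩
    congr 1
    exact funext hg

lemma continuous_update_multilinear (hμ : Continuous μ) (v : ∀ b, V b) (b : β) :
    Continuous fun u => μ (Function.update v b u) :=
  hμ.comp (continuous_const.update b continuous_id)

/-- The image of a vector under a multilinear map without zeros is semistable for a product of
groups if and only if all its components are. -/
lemma isSemistable_multilinear_iff (hμ : Continuous μ) (hne : ∀ v, (∀ b, v b ≠ 0) → μ v ≠ 0)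
    (hρ : ∀ g v, ρW g (μ v) = μ fun b => ρ b (g b) (v b)) :
    IsSemistable ρW (μ v) ↔ ∀ b, IsSemistable (ρ b) (v b) := by
  unfold IsSemistable
  rw [orbit_multilinear hρ]
  constructor
  · intro h b hb
    refine h ?_
    have h1 := image_closure_subset_closure_image (continuous_update_multilinear hμ v b)
      ⟨0, hb, rfl⟩
    simp only [MultilinearMap.map_update_zero] at h1
    refine closure_mono ?_ h1
    rintro _ ⟨u, hu, rfl⟩
    refine ⟨_, fun c _ => ?_, rfl⟩
    rcases eq_or_ne c b with rfl | hc
    · simpa using hu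
    · rw [Function.update_of_ne hc]
      exact ⟨1, by simp⟩
  · exact zero_notMem_closure_image_multilinear' μ hμ hne _

/-- The image of a vector with finite stabilizer under a multilinear map without zeros is polystable
for a product of groups if and only if all its components are. -/
lemma isPolystable_multilinear_iff (hμ : Continuous μ) (hne : ∀ v, (∀ b, v b ≠ 0) → μ v ≠ 0)
    (hρ : ∀ g v, ρW g (μ v) = μ fun b => ρ b (g b) (v b))
    (hρW : Continuous fun p : (∀ b, G b) × W => ρW p.1 p.2) (hv : ∀ b, v b ≠ 0)
    (hfin : {g | ρW g (μ v) = μ v}.Finite) :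
    IsPolystable ρW (μ v) ↔ ∀ b, IsPolystable (ρ b) (v b) := by
  have h0 : ∀ b, (0 : V b) ∉ orbit (ρ b) (v b) := fun b => zero_notMem_orbit _ (hv b)
  have : LocallyCompactSpace W := LocallyCompactSpace.of_finiteDimensional_of_complete ℂ W
  constructor
  · rintro ⟨hcl, -⟩ b
    refine ⟨?_, h0 b⟩
    -- the factor `G b`, whose orbit is the preimage of the orbit of a closed subgroup
    let N : Subgroup (∀ b, G b) := Subgroup.pi {b}ᶜ fun _ => ⊥
    have hN : IsClosed (N : Set (∀ b, G b)) := by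
      have : (N : Set (∀ b, G b)) = ({b}ᶜ : Set β).pi fun _ => {1} := by
        ext g; simp [N, Subgroup.mem_pi, Set.mem_pi]
      rw [this]
      exact isClosed_set_pi fun _ _ => isClosed_singleton
    have h1 := isClosed_range_of_isClosed_orbit ρW hρW (μ v) hcl hfin N hN
    have h2 := h1.preimage (continuous_update_multilinear hμ v b)
    convert h2 using 1
    ext u
    simp only [Set.mem_preimage, Set.mem_image, SetLike.mem_coe, hρ]
    constructor
    · rintro ⟨g, rfl⟩
      refine ⟨Pi.mulSingle b g, ?_, ?_⟩
      · intro c hc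
        simpa using Pi.mulSingle_eq_of_ne (show c ≠ b by simpa using hc) g
      · congr 1
        funext c
        rcases eq_or_ne c b with rfl | hc
        · simp
        · simp [Function.update_of_ne hc, Pi.mulSingle_eq_of_ne hc]
    · rintro ⟨g, hg, h⟩
      refine ⟨g b, ?_⟩
      have h3 : (fun c => ρ c (g c) (v c)) = Function.update v b (ρ b (g b) (v b)) := by
        funext c
        rcases eq_or_ne c b with rfl | hc
        · simp
        · have : g c = 1 := by simpa using hg c (by simpa using hc)
          simp [Function.update_of_ne hc, this]
      rw [h3, ← sub_eq_zero, ← MultilinearMap.map_update_sub] at h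
      by_contra hu
      refine hne _ (fun c => ?_) h
      rcases eq_or_ne c b with rfl | hc
      · simpa [sub_eq_zero] using hu
      · simpa [Function.update_of_ne hc] using hv c
  · intro h
    refine ⟨?_, zero_notMem_orbit _ (hne _ hv)⟩
    rw [orbit_multilinear hρ]
    exact isClosed_image_multilinear' μ hμ hne _ (fun b => (h b).1) h0

lemma finite_stabilizer_of_multilinear
    (hρ : ∀ g v, ρW g (μ v) = μ fun b => ρ b (g b) (v b))
    (hfin : {g | ρW g (μ v) = μ v}.Finite) (b : β) :
    {g : G b | ρ b g (v b) = v b}.Finite := by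
  refine Set.Finite.of_finite_image (f := fun g => (Pi.mulSingle b g : ∀ b, G b))
    (hfin.subset ?_) (Pi.mulSingle_injective b).injOn
  rintro _ ⟨g, hg, rfl⟩
  change ρW _ _ = _
  rw [hρ]
  congr 1
  funext c
  rcases eq_or_ne c b with rfl | hc
  · simpa using hg
  · simp [Pi.mulSingle_eq_of_ne hc]

end Product

/-! ### The form of a configuration as a product over the blocks -/

section BlockProduct

set_option linter.unusedSectionVars false

open Matrix

variable {σ β : Type*} [Fintype σ] [DecidableEq σ] [Fintype β] [DecidableEq β] {D : β → ℕ}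
  (B : Module.Basis (Σ b, Fin (D b)) ℂ (σ → ℂ))

/-- The inclusion of the forms on the span of a block of basis vectors, in the coordinates given by
these vectors: the `a`-th variable goes to the linear form of the `a`-th basis vector. -/
def blockIncl (b : β) : MvPolynomial (Fin (D b)) ℂ →ₐ[ℂ] MvPolynomial σ ℂ :=
  MvPolynomial.aeval fun a => linForm (B ⟨b, a⟩)

lemma blockIncl_linForm (b : β) (v : Fin (D b) → ℂ) :
    blockIncl B b (linForm v) = linForm (∑ a, v a • B ⟨b, a⟩) := by
  have : linForm (∑ a, v a • B ⟨b, a⟩) = ∑ a, linForm (v a • B ⟨b, a⟩) :=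
    map_sum (AddMonoidHom.mk' linForm linForm_add) _ _
  rw [this, linForm, map_sum]
  refine Finset.sum_congr rfl fun a _ => ?_
  rw [linForm_smul, map_mul, blockIncl, MvPolynomial.aeval_X, MvPolynomial.algHom_C,
    MvPolynomial.algebraMap_eq]

lemma blockIncl_injective (b : β) : Function.Injective (blockIncl B b) := by
  -- a left inverse: restriction to the block of the coordinates with respect to `B`
  let r : MvPolynomial σ ℂ →ₐ[ℂ] MvPolynomial (Fin (D b)) ℂ :=
    MvPolynomial.aeval fun k => linForm fun a => B.repr (Pi.single k 1) ⟨b, a⟩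
  have hr : r.comp (blockIncl B b) = AlgHom.id ℂ _ := by
    ext1 a
    have h1 : r (linForm (B ⟨b, a⟩)) =
        linForm fun a' => (B ⟨b, a⟩ ᵥ* rowMatrixInv B) ⟨b, a'⟩ := by
      simp only [linForm, r, map_sum, map_mul, MvPolynomial.aeval_X, MvPolynomial.algHom_C,
        MvPolynomial.algebraMap_eq, vecMul, dotProduct, rowMatrixInv, of_apply, Finset.sum_mul,
        Finset.mul_sum]
      rw [Finset.sum_comm]
      simp [mul_assoc]
    rw [AlgHom.comp_apply, blockIncl, MvPolynomial.aeval_X, h1, vecMul_rowMatrixInv, B.repr_self]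
    simp [linForm, Finsupp.single_apply]
  exact Function.LeftInverse.injective (g := r) fun f => AlgHom.congr_fun hr f

lemma substLinear_blockIncl (A : ∀ b, Matrix (Fin (D b)) (Fin (D b)) ℂ) (b : β)
    (f : MvPolynomial (Fin (D b)) ℂ) :
    substLinear (blk B A) (blockIncl B b f) = blockIncl B b (substLinear (A b) f) := by
  have : (substLinear (blk B A)).comp (blockIncl B b) =
      (blockIncl B b).comp (substLinear (A b)) := by
    ext1 a
    have h1 : substLinear (A b) (MvPolynomial.X a) = linForm (A b a) := by
      rw [substLinear, MvPolynomial.aeval_X, linForm]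
    rw [AlgHom.comp_apply, AlgHom.comp_apply, h1, blockIncl_linForm, blockIncl,
      MvPolynomial.aeval_X, substLinear_linForm, basis_vecMul_blk]
  exact AlgHom.congr_fun this f

/-- The product of forms on the blocks, as a multilinear map. -/
def blockProd (k : β → ℕ) {N : ℕ} (hN : ∑ b, k b = N) :
    MultilinearMap ℂ (fun b => Form (Fin (D b)) (k b)) (Form σ N) :=
  ((MultilinearMap.mkPiAlgebra ℂ β (MvPolynomial σ ℂ)).compLinearMap fun b =>
    (blockIncl B b).toLinearMap.comp (Submodule.subtype _)).codRestrict _ fun f => by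
      have := MvPolynomial.IsHomogeneous.prod (Finset.univ : Finset β)
        (fun b => blockIncl B b (f b).1) k fun b _ => by
          have := (f b).2.aeval (n := 1) (fun a => linForm (B ⟨b, a⟩))
            fun a => linForm_isHomogeneous _
          rwa [one_mul] at this
      rw [hN] at this
      simpa using this

variable {B}

lemma blockProd_coe {k : β → ℕ} {N : ℕ} (hN : ∑ b, k b = N) (f : ∀ b, Form (Fin (D b)) (k b)) :
    (blockProd B k hN f : MvPolynomial σ ℂ) = ∏ b, blockIncl B b (f b) := by
  simp [blockProd]

lemma continuous_blockProd {k : β → ℕ} {N : ℕ} (hN : ∑ b, k b = N) :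
    Continuous (blockProd B k hN) := by
  refine CoeffContinuous.continuous ?_
  simp only [blockProd_coe]
  refine CoeffContinuous.prod _ fun b _ d => ?_
  exact (CoeffContinuous.of_linear
    ((blockIncl B b).toLinearMap.comp (Submodule.subtype _)) d).comp (continuous_apply b)

lemma blockProd_ne_zero {k : β → ℕ} {N : ℕ} (hN : ∑ b, k b = N)
    {f : ∀ b, Form (Fin (D b)) (k b)} (hf : ∀ b, f b ≠ 0) : blockProd B k hN f ≠ 0 := by
  intro h
  have := congrArg Subtype.val h
  rw [blockProd_coe] at this
  refine Finset.prod_ne_zero_iff.2 (fun b _ h0 => hf b (Subtype.ext ?_)) this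
  exact blockIncl_injective B b (h0.trans (map_zero _).symm)

lemma formRep_blockProd {k : β → ℕ} {N : ℕ} (hN : ∑ b, k b = N)
    (g : ∀ b, SpecialLinearGroup (Fin (D b)) ℂ) (f : ∀ b, Form (Fin (D b)) (k b)) :
    formRep σ N (blockSL B g) (blockProd B k hN f) =
      blockProd B k hN fun b => formRep (Fin (D b)) (k b) (g b) (f b) := by
  refine Subtype.ext ?_
  rw [formRep_coe, blockProd_coe, blockProd_coe, ← map_inv, blockSL_coe, map_prod]
  exact Finset.prod_congr rfl fun b _ => substLinear_blockIncl B _ b _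

variable {κ : Type*} [Fintype κ] {P : κ → ℙ ℂ (σ → ℂ)} {W : β → Submodule ℂ (σ → ℂ)}
  {w : ∀ b, Module.Basis (Fin (D b)) ℂ (W b)}

/-- If every point lies in exactly one of the subspaces `W b`, then the points of `P` are the points
of the subconfigurations. -/
def sigmaIndicesEquiv (hP : ∀ i, ∃! b, (P i).submodule ≤ W b) : (Σ b, IndicesIn P (W b)) ≃ κ :=
  Equiv.ofBijective (fun x => x.2.1) ⟨by
    rintro ⟨b, i, hi⟩ ⟨b', i', hi'⟩ h
    obtain rfl : i = i' := h
    obtain rfl := (hP i).unique hi hi'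
    rfl, fun i => by
    obtain ⟨b, hb, -⟩ := hP i
    exact ⟨⟨b, i, hb⟩, rfl⟩⟩

lemma sum_card_indicesIn (hP : ∀ i, ∃! b, (P i).submodule ≤ W b) :
    ∑ b, Fintype.card (IndicesIn P (W b)) = Fintype.card κ := by
  rw [← Fintype.card_sigma]
  exact Fintype.card_congr (sigmaIndicesEquiv hP)

lemma exists_configForm_eq_smul_blockProd (hw : ∀ b a, B ⟨b, a⟩ = w b a)
    (hP : ∀ i, ∃! b, (P i).submodule ≤ W b) : ∃ c : ℂ, c ≠ 0 ∧
      configForm P = (c • blockProd B (fun b => Fintype.card (IndicesIn P (W b)))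
        (sum_card_indicesIn hP)) fun b => configForm (subConfig P (W b) (w b)) := by
  have h1 : ∀ b, ∀ i : IndicesIn P (W b), ∃ c : ℂ, c ≠ 0 ∧
      blockIncl B b (linForm (subConfig P (W b) (w b) i).rep) =
        MvPolynomial.C c * linForm (P i.1).rep := fun b i => by
    have hi : (P i.1).rep ∈ W b := (submodule_le_iff_rep_mem _ _).1 i.2
    obtain ⟨u, hu⟩ := Projectivization.exists_smul_eq_mk_rep ℂ
      ((w b).equivFun ⟨(P i.1).rep, hi⟩) (by
        rw [ne_eq, LinearEquiv.map_eq_zero_iff, Submodule.mk_eq_zero]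
        exact (P i.1).rep_nonzero)
    refine ⟨u, u.ne_zero, ?_⟩
    rw [← linForm_smul, subConfig, ← hu, blockIncl_linForm]
    congr 1
    have h2 := congrArg Subtype.val ((w b).sum_equivFun ⟨(P i.1).rep, hi⟩)
    simp only [AddSubmonoidClass.coe_finsetSum, SetLike.val_smul] at h2
    conv_rhs => rw [← h2, Finset.smul_sum]
    refine Finset.sum_congr rfl fun a _ => ?_
    rw [hw, smul_smul]
    rfl
  choose c hc hcf using h1
  have hc0 : ∏ b, ∏ i, c b i ≠ 0 :=
    Finset.prod_ne_zero_iff.2 fun b _ => Finset.prod_ne_zero_iff.2 fun i _ => hc b i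
  refine ⟨(∏ b, ∏ i, c b i)⁻¹, inv_ne_zero hc0, ?_⟩
  rw [_root_.smul_apply, eq_inv_smul_iff₀ hc0]
  refine Subtype.ext ?_
  rw [blockProd_coe]
  have h3 : ∀ b, blockIncl B b (configForm (subConfig P (W b) (w b))) =
      MvPolynomial.C (∏ i, c b i) * ∏ i : IndicesIn P (W b), linForm (P i.1).rep := fun b => by
    rw [configForm, map_prod, map_prod, ← Finset.prod_mul_distrib]
    exact Finset.prod_congr rfl fun i _ => hcf b i
  simp only [h3, Finset.prod_mul_distrib]
  change (∏ b, ∏ i, c b i) • ∏ k, linForm (P k).rep = _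
  rw [MvPolynomial.smul_eq_C_mul, map_prod]
  congr 1
  rw [← (sigmaIndicesEquiv hP).prod_comp, Fintype.prod_sigma]
  rfl

/-- The product of the groups `SL` of the blocks, acting on forms by block diagonal matrices. -/
def blockRep (B : Module.Basis (Σ b, Fin (D b)) ℂ (σ → ℂ)) (N : ℕ) :
    Representation ℂ (∀ b, SpecialLinearGroup (Fin (D b)) ℂ) (Form σ N) :=
  MonoidHom.comp (formRep σ N) (blockSL B)

lemma blockRep_apply {N : ℕ} (g : ∀ b, SpecialLinearGroup (Fin (D b)) ℂ) (f : Form σ N) :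
    blockRep B N g f = formRep σ N (blockSL B g) f := rfl

lemma continuous_blockRep (N : ℕ) :
    Continuous fun p : (∀ b, SpecialLinearGroup (Fin (D b)) ℂ) × Form σ N =>
      blockRep B N p.1 p.2 := by
  have h : Continuous fun p : (∀ b, SpecialLinearGroup (Fin (D b)) ℂ) × Form σ N =>
      (blockSL B p.1, p.2) := ((continuous_blockSL B).comp continuous_fst).prodMk continuous_snd
  have h' := (continuous_formRep N).comp h
  exact h'.congr fun p => (blockRep_apply p.1 p.2).symm

/-- The form of a configuration is the value at the forms of its parts of an equivariant continuous
multilinear map without zeros. -/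
lemma exists_multilinear (hw : ∀ b a, B ⟨b, a⟩ = w b a) (hP : ∀ i, ∃! b, (P i).submodule ≤ W b) :
    ∃ μ : MultilinearMap ℂ (fun b => Form (Fin (D b)) (Fintype.card (IndicesIn P (W b))))
        (Form σ (Fintype.card κ)),
      Continuous μ ∧ (∀ v, (∀ b, v b ≠ 0) → μ v ≠ 0) ∧
      (∀ g v, blockRep B _ g (μ v) = μ fun b => formRep (Fin (D b)) _ (g b) (v b)) ∧
      configForm P = μ fun b => configForm (subConfig P (W b) (w b)) := by
  obtain ⟨c, hc, h⟩ := exists_configForm_eq_smul_blockProd hw hP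
  refine ⟨_, (continuous_blockProd _).const_smul c,
    fun v hv => smul_ne_zero hc (blockProd_ne_zero _ hv), fun g v => ?_, h⟩
  rw [_root_.smul_apply, map_smul, blockRep_apply, formRep_blockProd, _root_.smul_apply]

lemma orbit_restrict_range {G G' V : Type*} [Group G] [Group G'] [AddCommGroup V] [Module ℂ V]
    (ρ : Representation ℂ G V) (f : G' →* G) (v : V) :
    orbit (restrict ρ f.range) v = orbit (MonoidHom.comp ρ f) v := by
  ext x
  constructor
  · rintro ⟨⟨_, g, rfl⟩, rfl⟩
    exact ⟨g, rfl⟩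
  · rintro ⟨g, rfl⟩
    exact ⟨⟨_, g, rfl⟩, rfl⟩

lemma configSemistableFor_range_blockSL_iff (hw : ∀ b a, B ⟨b, a⟩ = w b a)
    (hP : ∀ i, ∃! b, (P i).submodule ≤ W b) :
    ConfigSemistableFor (blockSL B).range P ↔
      ∀ b, ConfigSemistable (subConfig P (W b) (w b)) := by
  obtain ⟨μ, hμ, hne, hρ, h⟩ := exists_multilinear hw hP
  have := isSemistable_multilinear_iff hμ hne hρ
    (v := fun b => configForm (subConfig P (W b) (w b)))
  rwa [← h, IsSemistable, blockRep, ← orbit_restrict_range] at this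

lemma finite_stabilizer_blockRep (hB : IsAdaptedBasis P B) :
    {g | blockRep B _ g (configForm P) = configForm P}.Finite := by
  refine Set.Finite.of_finite_image (f := blockSL B)
    (hB.finite_range_inf_lineStabilizer.subset ?_) (blockSL_injective B).injOn
  rintro _ ⟨g, hg, rfl⟩
  refine ⟨⟨g, rfl⟩, ?_⟩
  change _ ∈ Submodule.span ℂ _
  rw [show formRep σ _ (blockSL B g) (configForm P) = configForm P from hg]
  exact Submodule.mem_span_singleton_self _

lemma configPolystableFor_range_blockSL_iff (hB : IsAdaptedBasis P B)
    (hw : ∀ b a, B ⟨b, a⟩ = w b a) (hP : ∀ i, ∃! b, (P i).submodule ≤ W b) :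
    ConfigPolystableFor (blockSL B).range P ↔
      ∀ b, ConfigPolystable (subConfig P (W b) (w b)) := by
  have hfin := finite_stabilizer_blockRep hB
  obtain ⟨μ, hμ, hne, hρ, h⟩ := exists_multilinear hw hP
  rw [h] at hfin
  have := isPolystable_multilinear_iff hμ hne hρ (continuous_blockRep _)
    (fun b => configForm_ne_zero _) hfin
  rwa [← h, IsPolystable, blockRep, ← orbit_restrict_range] at this

/-- All stabilizers involved are finite, so stability is the same as polystability. -/
lemma configStableFor_range_blockSL_iff (hB : IsAdaptedBasis P B)
    (hw : ∀ b a, B ⟨b, a⟩ = w b a) (hP : ∀ i, ∃! b, (P i).submodule ≤ W b) :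
    ConfigStableFor (blockSL B).range P ↔
      ∀ b, ConfigStable (subConfig P (W b) (w b)) := by
  have hfin := finite_stabilizer_blockRep hB
  have hpoly := configPolystableFor_range_blockSL_iff hB hw hP
  have h1 : {g : (blockSL B).range |
      restrict (formRep σ _) (blockSL B).range g (configForm P) = configForm P}.Finite := by
    refine (hfin.image (blockSL B).rangeRestrict).subset ?_
    rintro ⟨_, g, rfl⟩ hg
    exact ⟨g, hg, rfl⟩
  obtain ⟨μ, -, -, hρ, h⟩ := exists_multilinear hw hP
  rw [h] at hfin
  exact ⟨fun h b => ⟨hpoly.1 h.1 b, finite_stabilizer_of_multilinear hρ hfin b⟩,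
    fun h => ⟨hpoly.2 fun b => (h b).1, h1⟩⟩

end BlockProduct

/-! ### Configurations in projective spaces of dimension zero -/

section SizeOne

variable {τ κ : Type*} [Fintype τ] [DecidableEq τ] [Subsingleton τ] [Fintype κ]
  (P : κ → ℙ ℂ (τ → ℂ))

lemma subsingleton_specialLinearGroup : Subsingleton (Matrix.SpecialLinearGroup τ ℂ) := by
  refine ⟨fun g h => Subtype.ext ?_⟩
  have key : ∀ g : Matrix.SpecialLinearGroup τ ℂ, (g : Matrix τ τ ℂ) = 1 := fun g => by
    ext i j
    obtain rfl := Subsingleton.elim i j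
    have := g.2
    rw [Matrix.det_eq_elem_of_subsingleton _ i] at this
    simpa using this
  rw [key, key]

/-- In a projective space of dimension zero every configuration is stable, also the empty one: the
group is trivial. -/
lemma configStable_of_subsingleton : ConfigStable P := by
  have := subsingleton_specialLinearGroup (τ := τ)
  refine ⟨⟨?_, zero_notMem_orbit _ (configForm_ne_zero P)⟩, Set.toFinite _⟩
  exact (Set.finite_range _).isClosed

lemma configSemistable_of_configPolystable {τ : Type*} [Fintype τ] [DecidableEq τ]
    {P : κ → ℙ ℂ (τ → ℂ)} (h : ConfigPolystable P) : ConfigSemistable P := by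
  unfold ConfigSemistable IsSemistable
  rw [h.1.closure_eq]
  exact h.2

end SizeOne

/-! ### Adapted bases of irreducible decompositions -/

section Adapted

set_option linter.unusedSectionVars false

open Matrix Submodule

/-- A spanning set contains a basis of a complement of any given subspace. -/
lemma exists_basis_quotient {E : Type*} [AddCommGroup E] [Module ℂ E] [FiniteDimensional ℂ E]
    (Λ : Submodule ℂ E) {S : Set E} (hS : span ℂ S = ⊤) :
    ∃ (c : ℕ) (x : Fin c → E), (∀ k, x k ∈ S) ∧ LinearIndependent ℂ (Λ.mkQ ∘ x) ∧
      Λ ⊔ span ℂ (Set.range x) = ⊤ := by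
  obtain ⟨ι, a, -, hspan, hli⟩ := exists_linearIndependent' ℂ fun v : S => Λ.mkQ v
  have : Finite ι := hli.finite
  let e : Fin (Nat.card ι) ≃ ι := (Finite.equivFin ι).symm
  refine ⟨Nat.card ι, fun k => a (e k), fun k => (a (e k)).2, hli.comp e e.injective, ?_⟩
  have h1 : Set.range (fun k => ((a (e k) : S) : E)) = Set.range fun k => ((a k : S) : E) :=
    e.surjective.range_comp fun k => ((a k : S) : E)
  have h2 : (span ℂ (Set.range fun k => ((a k : S) : E))).map Λ.mkQ = ⊤ := by
    rw [map_span, ← Set.range_comp]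
    refine hspan.trans ?_
    have : Set.range (fun v : S => Λ.mkQ v) = Λ.mkQ '' S := by
      rw [Set.image_eq_range]
    rw [this, ← map_span, hS, Submodule.map_top, range_mkQ]
  rw [h1, ← comap_map_mkQ, h2, comap_top]

lemma disjoint_span_of_linearIndependent_mkQ {E : Type*} [AddCommGroup E] [Module ℂ E]
    {Λ : Submodule ℂ E} {c : ℕ} {x : Fin c → E} (hx : LinearIndependent ℂ (Λ.mkQ ∘ x)) :
    Disjoint Λ (span ℂ (Set.range x)) := by
  refine Submodule.disjoint_def.2 fun v hv hv' => ?_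
  obtain ⟨a, rfl⟩ := (mem_span_range_iff_exists_fun ℂ).1 hv'
  have h1 : ∑ k, a k • (Λ.mkQ ∘ x) k = 0 := by
    have := (Submodule.Quotient.mk_eq_zero Λ).2 hv
    rw [← mkQ_apply, map_sum] at this
    simpa using this
  have h2 := Fintype.linearIndependent_iff.1 hx a h1
  exact Finset.sum_eq_zero fun k _ => by rw [h2, zero_smul]

lemma span_range_coe_basis {E τ : Type*} [AddCommGroup E] [Module ℂ E] {W : Submodule ℂ E}
    (b : Module.Basis τ ℂ W) : span ℂ (Set.range fun a => (b a : E)) = W := by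
  have : Set.range (fun a => (b a : E)) = W.subtype '' Set.range b := by
    rw [← Set.range_comp]; rfl
  rw [this, ← map_span, b.span_eq, Submodule.map_top, range_subtype]

lemma linearIndependent_sigma_of_iSupIndep {E : Type*} [AddCommGroup E] [Module ℂ E] {s : ℕ}
    {d : Fin s → ℕ} {L : Fin s → Submodule ℂ E} (hL : iSupIndep L)
    (b : ∀ j, Module.Basis (Fin (d j)) ℂ (L j)) :
    LinearIndependent ℂ fun i : Σ j, Fin (d j) => (b i.1 i.2 : E) := by
  have h0 : ∀ j, LinearIndependent ℂ fun a => (b j a : E) := fun j =>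
    (b j).linearIndependent.map' (L j).subtype (L j).ker_subtype
  refine linearIndependent_iUnion_finite h0 fun j t _ hj => ?_
  simp only [span_range_coe_basis]
  exact hL.disjoint_biSup hj

variable {σ κ : Type*} [Fintype σ] [DecidableEq σ] [Fintype κ] {P : κ → ℙ ℂ (σ → ℂ)} {s : ℕ}
  {L : Fin s → Submodule ℂ (σ → ℂ)} {d : Fin s → ℕ} {c : ℕ}

/-- The sizes of the blocks: the dimensions of the summands of a decomposition, followed by blocks
of size one for a complement. -/
abbrev blockSize (d : Fin s → ℕ) (c : ℕ) : Fin s ⊕ Fin c → ℕ :=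
  Sum.elim d fun _ => 1

lemma exists_basis_of_decomposition (hL : IsOrthogonalDecomposition P L)
    (b : ∀ j, Module.Basis (Fin (d j)) ℂ (L j)) {x : Fin c → σ → ℂ}
    (hx : LinearIndependent ℂ ((⨆ j, L j).mkQ ∘ x))
    (hx' : (⨆ j, L j) ⊔ span ℂ (Set.range x) = ⊤) :
    ∃ B : Module.Basis (Σ i, Fin (blockSize d c i)) ℂ (σ → ℂ),
      (∀ j a, B ⟨Sum.inl j, a⟩ = b j a) ∧ ∀ k a, B ⟨Sum.inr k, a⟩ = x k := by
  have h1 := linearIndependent_sigma_of_iSupIndep hL.orthogonal b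
  have h1' : span ℂ (Set.range fun i : Σ j, Fin (d j) => (b i.1 i.2 : σ → ℂ)) = ⨆ j, L j := by
    rw [Set.range_sigma_eq_iUnion_range, span_iUnion]
    simp only [span_range_coe_basis]
  have h2 : LinearIndependent ℂ fun i : Σ _ : Fin c, Fin 1 => x i.1 :=
    (LinearIndependent.of_comp _ hx).comp (fun i : Σ _ : Fin c, Fin 1 => i.1) fun i j h =>
      Sigma.ext h (heq_of_eq (Subsingleton.elim _ _))
  have h2' : Set.range (fun i : Σ _ : Fin c, Fin 1 => x i.1) = Set.range x := by
    ext v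
    exact ⟨fun ⟨i, hi⟩ => ⟨i.1, hi⟩, fun ⟨k, hk⟩ => ⟨⟨k, 0⟩, hk⟩⟩
  have h3 := h1.sum_type h2 (by
    rw [h1', h2']
    exact disjoint_span_of_linearIndependent_mkQ hx)
  let B₀ := Module.Basis.mk h3 (by
    rw [Set.Sum.elim_range, span_union, h1', h2', hx'])
  let e : (Σ i, Fin (blockSize d c i)) ≃ (Σ j, Fin (d j)) ⊕ (Σ _ : Fin c, Fin 1) :=
    Equiv.sumSigmaDistrib fun i : Fin s ⊕ Fin c => Fin (blockSize d c i)
  have hB : ∀ i, B₀.reindex e.symm i =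
      Sum.elim (fun i : Σ j, Fin (d j) => (b i.1 i.2 : σ → ℂ)) (fun i => x i.1) (e i) := fun i => by
    rw [Module.Basis.reindex_apply, Module.Basis.mk_apply, Equiv.symm_symm]
  exact ⟨B₀.reindex e.symm, fun j a => hB ⟨Sum.inl j, a⟩, fun k a => hB ⟨Sum.inr k, a⟩⟩

/-- The subspaces spanned by the blocks. -/
def blockSpace (L : Fin s → Submodule ℂ (σ → ℂ)) (x : Fin c → σ → ℂ) :
    Fin s ⊕ Fin c → Submodule ℂ (σ → ℂ) :=
  Sum.elim L fun k => span ℂ (Set.range fun _ : Fin 1 => x k)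

/-- The bases of the subspaces spanned by the blocks. -/
def blockBasis (b : ∀ j, Module.Basis (Fin (d j)) ℂ (L j)) {x : Fin c → σ → ℂ}
    (hx : ∀ k, x k ≠ 0) : ∀ i, Module.Basis (Fin (blockSize d c i)) ℂ (blockSpace L x i)
  | Sum.inl j => b j
  | Sum.inr k => Module.Basis.span
      (v := fun _ : Fin 1 => x k) (LinearIndependent.of_subsingleton 0 (hx k))

lemma existsUnique_le_blockSpace (hL : IsOrthogonalDecomposition P L) {x : Fin c → σ → ℂ}
    (hx : Disjoint (⨆ j, L j) (span ℂ (Set.range x))) (i : κ) :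
    ∃! l, (P i).submodule ≤ blockSpace L x l := by
  obtain ⟨j, hj⟩ := hL.covers i
  refine ⟨Sum.inl j, hj, ?_⟩
  rintro (j' | k) h
  · exact congrArg Sum.inl (eq_of_submodule_le hL h hj)
  · refine absurd ?_ (P i).rep_nonzero
    rw [submodule_le_iff_rep_mem] at h hj
    refine Submodule.disjoint_def.1 hx _ (mem_iSup_of_mem j hj) (span_mono ?_ h)
    rintro _ ⟨-, rfl⟩
    exact ⟨k, rfl⟩

section

variable {b : ∀ j, Module.Basis (Fin (d j)) ℂ (L j)} {x : Fin c → σ → ℂ}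
  {B : Module.Basis (Σ i, Fin (blockSize d c i)) ℂ (σ → ℂ)}

lemma mem_span_block_of_mem (hBl : ∀ j a, B ⟨Sum.inl j, a⟩ = b j a) {j : Fin s} {v : σ → ℂ}
    (hv : v ∈ L j) : v ∈ span ℂ (Set.range fun a => B ⟨Sum.inl j, a⟩) := by
  refine (mem_span_range_iff_exists_fun ℂ).2 ⟨(b j).equivFun ⟨v, hv⟩, ?_⟩
  have := congrArg Subtype.val ((b j).sum_equivFun ⟨v, hv⟩)
  simp only [AddSubmonoidClass.coe_finsetSum, SetLike.val_smul] at this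
  simp only [hBl]
  exact this

/-- The basis obtained from bases of the summands of an irreducible decomposition and of a
complement is adapted to the configuration. -/
lemma isAdaptedBasis_of_irreducible (hL : IsIrreducibleDecomposition P L)
    (hBl : ∀ j a, B ⟨Sum.inl j, a⟩ = b j a) : IsAdaptedBasis P B where
  pos := by
    rintro (j | k)
    · obtain ⟨i, hi⟩ := hL.1.meets j
      rw [submodule_le_iff_rep_mem] at hi
      by_contra h
      have h0 : d j = 0 := by simpa using h
      have : IsEmpty (Fin (d j)) := by rw [h0]; infer_instance
      have : Subsingleton (L j) := (b j).repr.toEquiv.subsingleton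
      exact (P i).rep_nonzero
        (congrArg Subtype.val (Subsingleton.elim (⟨_, hi⟩ : L j) 0))
    · exact one_pos
  mem i := by
    obtain ⟨j, hj⟩ := hL.1.covers i
    exact ⟨Sum.inl j, mem_span_block_of_mem hBl ((submodule_le_iff_rep_mem _ _).1 hj)⟩
  scalar A hA := by
    have hD : ∀ (j : Fin s), ∀ w ∈ L j,
        (blkScalar B (Sum.elim (fun j => (j : ℂ)) 0)).vecMulLinear w = (j : ℂ) • w :=
      fun j w hw => vecMul_blkScalar_of_mem (mem_span_block_of_mem hBl hw) _
    choose l hl using exists_scalar_of_irreducible hL _ hD (blk B A).vecMulLinear hA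
    refine ⟨Sum.elim l fun k => A (Sum.inr k) (0 : Fin 1) (0 : Fin 1), (eq_blkScalar_iff B).2 ?_⟩
    rintro ⟨j | k, a⟩
    · have : B ⟨Sum.inl j, a⟩ ∈ L j := by
        rw [hBl]
        exact (b j a).2
      exact hl j _ this
    · rw [basis_vecMul_blk]
      change Fin 1 at a
      obtain rfl := Subsingleton.elim a 0
      exact Fin.sum_univ_one _

/-- A torus in the stabilizer of the line of `f_P` fixes all points of `P`, as it is divisible; so
it preserves the summands of the decomposition. -/
lemma exists_eq_blk_of_isTorus (hL : IsOrthogonalDecomposition P L)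
    (hBl : ∀ j a, B ⟨Sum.inl j, a⟩ = b j a) (hBr : ∀ k a, B ⟨Sum.inr k, a⟩ = x k)
    {T : Subgroup (SpecialLinearGroup σ ℂ)} (hT : IsTorus T)
    (hTP : T ≤ lineStabilizer (formRep σ _) (configForm P))
    (hx : ∀ k, ∀ t ∈ T, ∃ z : ℂ, x k ᵥ* (t : Matrix σ σ ℂ) = z • x k)
    {t : SpecialLinearGroup σ ℂ} (ht : t ∈ T) : ∃ A, (t : Matrix σ σ ℂ) = blk B A := by
  obtain ⟨N, hN, hfix⟩ := exists_pow_fixes P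
  obtain ⟨t', ht', rfl⟩ := hT.exists_pow_eq hN ht
  have hfix' := hfix t' (hTP ht')
  generalize t' ^ N = t at hfix' ht
  have key : ∀ i a, B ⟨i, a⟩ ᵥ* (t : Matrix σ σ ℂ) ∈ span ℂ (Set.range fun a' => B ⟨i, a'⟩) := by
    rintro (j | k) a
    · refine mem_span_block_of_mem hBl ?_
      have h1 : (⨆ (i) (_ : (P i).submodule ≤ L j), (P i).submodule) ≤
          (L j).comap (t : Matrix σ σ ℂ).vecMulLinear := by
        refine iSup₂_le fun i hi => ?_
        rw [submodule_le_iff_rep_mem] at hi ⊢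
        obtain ⟨z, hz⟩ := hfix' i
        rw [mem_comap, vecMulLinear_apply, hz]
        exact (L j).smul_mem z hi
      refine h1 (le_iSup_submodule hL j ?_)
      rw [hBl]
      exact (b j a).2
    · obtain ⟨z, hz⟩ := hx k t ht
      have : B ⟨Sum.inr k, a⟩ ᵥ* (t : Matrix σ σ ℂ) = z • B ⟨Sum.inr k, a⟩ := by
        rw [hBr, hz]
      rw [this]
      exact smul_mem _ _ (subset_span ⟨a, rfl⟩)
  choose A hA using fun i a => (mem_span_range_iff_exists_fun ℂ).1 (key i a)
  exact ⟨A, (eq_blk_iff B).2 fun i a => (hA i a).symm⟩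

end

/-- Relative stability is stability of the parts. For existence any complement of the span will do;
for a given datum the complement is spanned by eigenvectors of the torus. -/
theorem relative_stability_iff [Nonempty σ] (hL : IsIrreducibleDecomposition P L)
    (b : ∀ j, Module.Basis (Fin (d j)) ℂ (L j)) :
    (∃ T H : Subgroup (SpecialLinearGroup σ ℂ), ConfigRelativeDatum P T H) ∧
    ∀ T H : Subgroup (SpecialLinearGroup σ ℂ), ConfigRelativeDatum P T H →
      (ConfigSemistableFor H P ↔ ∀ j, ConfigSemistable (subConfig P (L j) (b j))) ∧
      (ConfigPolystableFor H P ↔ ∀ j, ConfigPolystable (subConfig P (L j) (b j))) ∧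
      (ConfigStableFor H P ↔ ∀ j, ConfigStable (subConfig P (L j) (b j))) := by
  constructor
  · obtain ⟨c, x, -, hx, hx'⟩ := exists_basis_quotient (⨆ j, L j) (span_univ (R := ℂ) (M := σ → ℂ))
    obtain ⟨B, hBl, -⟩ := exists_basis_of_decomposition hL.1 b hx hx'
    have hB := isAdaptedBasis_of_irreducible hL hBl
    have : Nonempty (Fin s ⊕ Fin c) := B.index_nonempty.map Sigma.fst
    obtain ⟨e, q, u, he, hq, hq0, hu⟩ := exists_primitive_exponents hB.pos
    exact ⟨_, _, hB.configRelativeDatum he hq hq0 u hu⟩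
  · rintro T H ⟨hT, hH⟩
    -- the vectors of the complement are chosen among the common eigenvectors of the torus
    obtain ⟨c, x, hxT, hx, hx'⟩ :=
      exists_basis_quotient (⨆ j, L j) hT.1.1.span_eigenvectors_eq_top
    obtain ⟨B, hBl, hBr⟩ := exists_basis_of_decomposition hL.1 b hx hx'
    have hB := isAdaptedBasis_of_irreducible hL hBl
    have : Nonempty (Fin s ⊕ Fin c) := B.index_nonempty.map Sigma.fst
    obtain ⟨e, q, u, he, hq, hq0, hu⟩ := exists_primitive_exponents hB.pos
    obtain rfl := hB.eq_scalarTorus hq hq0 u hu hT fun t ht =>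
      exists_eq_blk_of_isTorus hL.1 hBl hBr hT.1.1 hT.1.2 hxT ht
    obtain rfl := eq_range_blockSL_of_isLift B hB.pos he hq hH
    have hx0 : ∀ k, x k ≠ 0 := fun k h => hx.ne_zero k (by simp [h])
    have hw : ∀ i a, B ⟨i, a⟩ = blockBasis b hx0 i a := by
      rintro (j | k) a
      · exact hBl j a
      · exact (hBr k a).trans (congrArg Subtype.val (Module.Basis.span_apply
          (LinearIndependent.of_subsingleton (v := fun _ : Fin 1 => x k) 0 (hx0 k)) a).symm)
    have hP := existsUnique_le_blockSpace hL.1 (disjoint_span_of_linearIndependent_mkQ hx)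
    have h1 : ∀ k, ConfigStable (subConfig P (blockSpace L x (Sum.inr k))
        (blockBasis b hx0 (Sum.inr k))) := fun k => by
      have : Subsingleton (Fin (blockSize d c (Sum.inr k))) :=
        inferInstanceAs (Subsingleton (Fin 1))
      exact configStable_of_subsingleton _
    refine ⟨(configSemistableFor_range_blockSL_iff hw hP).trans ?_,
      (configPolystableFor_range_blockSL_iff hB hw hP).trans ?_,
      (configStableFor_range_blockSL_iff hB hw hP).trans ?_⟩
    -- the blocks of size one impose no condition
    · exact Sum.forall.trans
        (and_iff_left fun k => configSemistable_of_configPolystable (h1 k).1)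
    · exact Sum.forall.trans (and_iff_left fun k => (h1 k).1)
    · exact Sum.forall.trans (and_iff_left h1)

end Adapted

end

end RelGIT

theorem mainTheorem4 (n m : ℕ)
    (P : Fin m → Projectivization ℂ (Fin (n + 1) → ℂ))
    (s : ℕ) (L : Fin s → Submodule ℂ (Fin (n + 1) → ℂ))
    (hL : RelGIT.IsIrreducibleDecomposition P L)
    (d : Fin s → ℕ) (b : ∀ j, Module.Basis (Fin (d j)) ℂ (L j)) :
    (∃ T H : Subgroup (Matrix.SpecialLinearGroup (Fin (n + 1)) ℂ),
      RelGIT.ConfigRelativeDatum P T H) ∧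
    ∀ T H : Subgroup (Matrix.SpecialLinearGroup (Fin (n + 1)) ℂ),
      RelGIT.ConfigRelativeDatum P T H →
      (RelGIT.ConfigSemistableFor H P ↔
        ∀ j, RelGIT.ConfigSemistable (RelGIT.subConfig P (L j) (b j))) ∧
      (RelGIT.ConfigPolystableFor H P ↔
        ∀ j, RelGIT.ConfigPolystable (RelGIT.subConfig P (L j) (b j))) ∧
      (RelGIT.ConfigStableFor H P ↔
        ∀ j, RelGIT.ConfigStable (RelGIT.subConfig P (L j) (b j))) :=
  RelGIT.relative_stability_iff hL b
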